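/- Let $(X,d,\mu)$ be a metric measure space, i.e. a metric space with a Borel measure $\mu$ such that $0<\mu(B(x,r))<\infty$ for all open balls. **Exponents.** $\mathcal P(X)$ is the set of measurable $p:X\to(0,\infty]$ with $\operatorname{ess\,inf}p>0$; $\mathcal P_b(X)$ is the set of essentially bounded $p\in\mathcal P(X)$; $\mathcal P_b^{\log}(X)$ is the set of $p\in\mathcal P_b(X)$ for which there is $C>0$ with $|1/p(x)-1/p(y)|\le C/\log(e+1/d(x,y))$ for all $x,y\in X$. We write $p_1\ll p_2$ if $\operatorname{ess\,inf}(p_2-p_1)>0$; inequalities $p_1\le p_2$ are understood $\mu$-a.e. The measure $\mu$ is lower Ahlfors $Q(\cdot)$-regular if there is $b>0$ with $\mu(B(x,r))\ge b\,r^{Q(x)}$ for all $x\in X$, $r\in(0,1]$. **Spaces.** Functions are identified if they agree $\mu$-a.e. For $p\in\mathcal P(X)$ and measurable $f$ put $\rho_{p(\cdot)}(f)=\int_X\varphi_{p(x)}(|f(x)|)\,d\mu(x)$, where $\varphi_p(t)=t^p$ for $p<\infty$, $\varphi_\infty(t)=0$ for $t\le1$ and $\varphi_\infty(t)=\infty$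 for $t>1$. $L^{p(\cdot)}(X,\mu)$ is the space of measurable $f$ with $\rho_{p(\cdot)}(\lambda f)<\infty$ for some $\lambda>0$, with $\|f\|_{L^{p(\cdot)}}=\inf\{\lambda>0:\rho_{p(\cdot)}(f/\lambda)\le1\}$. For a sequence $g=(g_k)_{k\in\mathbb Z}$ of non-negative measurable functions put $$\|g\|_{L^{p(\cdot)}(\ell^{q(\cdot)})}=\Big\|\,x\mapsto\|(g_k(x))_k\|_{\ell^{q(x)}}\Big\|_{L^{p(\cdot)}},\qquad \|g\|_{\ell^{q(\cdot)}(L^{p(\cdot)})}=\inf\{\lambda>0:\rho_{\ell^{q(\cdot)}(L^{p(\cdot)})}(g/\lambda)\le1\},$$ $$\rho_{\ell^{q(\cdot)}(L^{p(\cdot)})}(g)=\sum_{k\in\mathbb Z}\inf\{\lambda_k>0:\rho_{p(\cdot)}(g_k/\lambda_k^{1/q(\cdot)})\le1\},\qquad \lambda^{1/\infty}:=1.$$ Let $u$ be measurable and finite a.e. The sequence $g$ is a vector $s(\cdot)$-gradient of $u$, $g\in\mathbb D^{s(\cdot)}(u)$, if there is a $\mu$-null set $N$ such that for all $k\in\mathbb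 Z$ and all $x,y\in X\setminus N$ with $2^{-k-1}\le d(x,y)<2^{-k}$ $$|u(x)-u(y)|\le d(x,y)^{s(x)}g_k(x)+d(x,y)^{s(y)}g_k(y).$$ The Haj\l{}asz–Triebel–Lizorkin space $M^{s(\cdot)}_{p(\cdot),q(\cdot)}(X,d,\mu)$, resp. the Haj\l{}asz–Besov space $N^{s(\cdot)}_{p(\cdot),q(\cdot)}(X,d,\mu)$, consists of all $u\in L^{p(\cdot)}(X,\mu)$ with finite quasi-norm $$\|u\|_{L^{p(\cdot)}}+\inf_{g\in\mathbb D^{s(\cdot)}(u)}\|g\|_{L^{p(\cdot)}(\ell^{q(\cdot)})},\qquad\text{resp.}\qquad \|u\|_{L^{p(\cdot)}}+\inf_{g\in\mathbb D^{s(\cdot)}(u)}\|g\|_{\ell^{q(\cdot)}(L^{p(\cdot)})}.$$ $A\hookrightarrow\hookrightarrow B$ means that $A\subseteq B$, that the inclusion is bounded, and that every bounded sequence in $A$ has a subsequence converging in $B$. **Theorem (Rellich–Kondrachov for Besov and Triebel–Lizorkin spaces).** Let $(X,d,\mu)$ be totally bounded and $\mu$ lower Ahlfors $Q(\cdot)$-regular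 for some $Q\in\mathcal P_b^{\log}(X)$. Let $q\in\mathcal P(X)$ and let $p,s\in\mathcal P_b^{\log}(X)$ satisfy $sp\ll Q$. Put $\gamma:=Qp/(Q-sp)$. Then: (i) $M^{s(\cdot)}_{p(\cdot),q(\cdot)}(X,d,\mu)\hookrightarrow\hookrightarrow L^{\beta(\cdot)}(X,\mu)$ for every $\beta\in\mathcal P_b(X)$ with $p\le\beta\ll\gamma$. (ii) If $q\le p$, then $N^{s(\cdot)}_{p(\cdot),q(\cdot)}(X,d,\mu)\hookrightarrow\hookrightarrow L^{\beta(\cdot)}(X,\mu)$ for every $\beta\in\mathcal P_b(X)$ with $p\le\beta\ll\gamma$. (iii) For every $t\in\mathcal P_b^{\log}(X)$ with $t\ll s$ and every $\beta\in\mathcal P_b(X)$ with $p\le\beta\ll\sigma$, where $\sigma:=Qp/(Q-tp)$, we have $N^{s(\cdot)}_{p(\cdot),q(\cdot)}(X,d,\mu)\hookrightarrow\hookrightarrow L^{\beta(\cdot)}(X,\mu)$. -/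

import Mathlib

open MeasureTheory Filter Topology
open scoped ENNReal NNReal

/-! ## Variable exponents

All exponents are functions with values in `[0,∞]`; strict positivity is part of `VarExponent`. -/

/-- `p ∈ 𝒫(X)`: a measurable function `p : X → (0,∞]` with `ess inf p > 0`. -/
structure VarExponent {X : Type*} [MeasurableSpace X] (μ : Measure X) (p : X → ℝ≥0∞) : Prop where
  measurable : Measurable p
  ne_zero : ∀ x, p x ≠ 0
  essInf_pos : 0 < essInf p μ

/-- `p ∈ 𝒫_b(X)`: a variable exponent that is essentially bounded. -/
structure BddVarExponent {X : Type*} [MeasurableSpace X] (μ : Measure X) (p : X → ℝ≥0∞) : Prop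
    extends VarExponent μ p where
  essSup_lt_top : essSup p μ < ∞

/-- `f` is locally log-Hölder continuous. (For `x = y` both sides of the inequality are
harmless: the left one is `0` and the right one is nonnegative.) -/
def LocLogHolder {X : Type*} [MetricSpace X] (f : X → ℝ) : Prop :=
  ∃ C : ℝ, 0 < C ∧ ∀ x y : X, |f x - f y| ≤ C / Real.log (Real.exp 1 + 1 / dist x y)

/-- `p ∈ 𝒫_b^log(X)`: a bounded variable exponent such that `1/p` is locally log-Hölder
continuous. -/
structure BddLogExponent {X : Type*} [MetricSpace X] [MeasurableSpace X] (μ : Measure X)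
    (p : X → ℝ≥0∞) : Prop extends BddVarExponent μ p where
  logHolder : LocLogHolder (fun x => ((p x)⁻¹).toReal)

/-- `p₁ ≪ p₂`: `ess inf (p₂ - p₁) > 0`. (Truncating the difference at `0` does not change
whether its essential infimum is positive.) -/
def StrictlyBelow {X : Type*} [MeasurableSpace X] (μ : Measure X) (p₁ p₂ : X → ℝ≥0∞) : Prop :=
  0 < essInf (fun x => p₂ x - p₁ x) μ

/-- `Q p / (Q - s p)`. -/
noncomputable def sobolevExponent {X : Type*} (Q s p : X → ℝ≥0∞) : X → ℝ≥0∞ :=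
  fun x => Q x * p x / (Q x - s x * p x)

/-- `μ` is lower Ahlfors `Q(·)`-regular. -/
def LowerAhlforsRegular {X : Type*} [MetricSpace X] [MeasurableSpace X] (μ : Measure X)
    (Q : X → ℝ≥0∞) : Prop :=
  ∃ b : ℝ, 0 < b ∧ ∀ (x : X) (r : ℝ), 0 < r → r ≤ 1 →
    ENNReal.ofReal (b * r ^ (Q x).toReal) ≤ μ (Metric.ball x r)

/-! ## Variable exponent Lebesgue spaces

Moduli and quasi-norms are defined for nonnegative functions `X → [0,∞]` and take values in
`[0,∞]`. The elements of the function spaces are classes, modulo equality almost everywhere, of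
measurable functions that are finite almost everywhere, that is, elements of `X →ₘ[μ] ℝ`. -/

/-- `φ_p(t)`, for `p ∈ (0,∞]` and `t ∈ [0,∞]`. -/
noncomputable def phiExp (p t : ℝ≥0∞) : ℝ≥0∞ :=
  open Classical in
  if p = ∞ then (if t ≤ 1 then 0 else ∞) else t ^ p.toReal

/-- The semimodular `ρ_{p(·)}(f) = ∫ φ_{p(x)}(f(x)) dμ(x)` for `f ≥ 0`. -/
noncomputable def varModular {X : Type*} [MeasurableSpace X] (μ : Measure X) (p : X → ℝ≥0∞)
    (f : X → ℝ≥0∞) : ℝ≥0∞ :=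
  ∫⁻ x, phiExp (p x) (f x) ∂μ

/-- The Luxemburg quasi-norm of `f ≥ 0` (it is `∞` if no admissible `c` exists). -/
noncomputable def luxNorm {X : Type*} [MeasurableSpace X] (μ : Measure X) (p : X → ℝ≥0∞)
    (f : X → ℝ≥0∞) : ℝ≥0∞ :=
  sInf {c : ℝ≥0∞ | 0 < c ∧ c < ∞ ∧ varModular μ p (fun x => f x / c) ≤ 1}

/-- The space `L^{p(·)}(X,μ)`. -/
def varLebesgue {X : Type*} [MeasurableSpace X] (μ : Measure X) (p : X → ℝ≥0∞) :
    Set (X →ₘ[μ] ℝ) :=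
  {u | ∃ c : ℝ≥0∞, 0 < c ∧ c < ∞ ∧ varModular μ p (fun x => c * ‖u x‖ₑ) < ∞}

/-- The quasi-norm of `L^{p(·)}(X,μ)`. -/
noncomputable def varLebesgueNorm {X : Type*} [MeasurableSpace X] (μ : Measure X)
    (p : X → ℝ≥0∞) (u : X →ₘ[μ] ℝ) : ℝ≥0∞ :=
  luxNorm μ p (fun x => ‖u x‖ₑ)

/-! ## Mixed Lebesgue sequence spaces -/

/-- The `ℓ^q(ℤ)` quasi-norm of a nonnegative sequence, `q ∈ (0,∞]`. -/
noncomputable def seqNorm (q : ℝ≥0∞) (a : ℤ → ℝ≥0∞) : ℝ≥0∞ :=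
  open Classical in
  if q = ∞ then ⨆ k, a k else (∑' k, a k ^ q.toReal) ^ (1 / q.toReal)

/-- The quasi-norm of `L^{p(·)}(ℓ^{q(·)})` of a sequence of nonnegative functions. -/
noncomputable def LpSeqNorm {X : Type*} [MeasurableSpace X] (μ : Measure X) (p q : X → ℝ≥0∞)
    (g : ℤ → X → ℝ≥0∞) : ℝ≥0∞ :=
  luxNorm μ p (fun x => seqNorm (q x) (fun k => g k x))

/-- The semimodular of `ℓ^{q(·)}(L^{p(·)})` of a sequence of nonnegative functions. Here
`c ^ (1/q(x))` is `1` where `q(x) = ∞`. -/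
noncomputable def seqLpModular {X : Type*} [MeasurableSpace X] (μ : Measure X)
    (p q : X → ℝ≥0∞) (g : ℤ → X → ℝ≥0∞) : ℝ≥0∞ :=
  ∑' k : ℤ, sInf {c : ℝ≥0∞ | 0 < c ∧ c < ∞ ∧
    varModular μ p (fun x => g k x / c ^ ((q x)⁻¹).toReal) ≤ 1}

/-- The quasi-norm of `ℓ^{q(·)}(L^{p(·)})` of a sequence of nonnegative functions. -/
noncomputable def seqLpNorm {X : Type*} [MeasurableSpace X] (μ : Measure X) (p q : X → ℝ≥0∞)
    (g : ℤ → X → ℝ≥0∞) : ℝ≥0∞ :=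
  sInf {c : ℝ≥0∞ | 0 < c ∧ c < ∞ ∧ seqLpModular μ p q (fun k x => g k x / c) ≤ 1}

/-! ## Hajłasz–Triebel–Lizorkin and Hajłasz–Besov spaces -/

/-- `g = (g_k)_{k ∈ ℤ}` is a vector `s(·)`-gradient of `u`. -/
def IsVectorGradient {X : Type*} [MetricSpace X] [MeasurableSpace X] {μ : Measure X}
    (s : X → ℝ≥0∞) (u : X →ₘ[μ] ℝ) (g : ℤ → X → ℝ≥0∞) : Prop :=
  (∀ k, Measurable (g k)) ∧
  ∃ N : Set X, μ N = 0 ∧ ∀ (k : ℤ) (x y : X), x ∉ N → y ∉ N →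
    (2 : ℝ) ^ (-k - 1) ≤ dist x y → dist x y < (2 : ℝ) ^ (-k) →
      ‖u x - u y‖ₑ ≤ edist x y ^ (s x).toReal * g k x + edist x y ^ (s y).toReal * g k y

/-- The quasi-seminorm of the homogeneous Hajłasz–Triebel–Lizorkin space. -/
noncomputable def homTLNorm {X : Type*} [MetricSpace X] [MeasurableSpace X] (μ : Measure X)
    (s p q : X → ℝ≥0∞) (u : X →ₘ[μ] ℝ) : ℝ≥0∞ :=
  ⨅ g : {g : ℤ → X → ℝ≥0∞ // IsVectorGradient s u g}, LpSeqNorm μ p q g.1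

/-- The quasi-seminorm of the homogeneous Hajłasz–Besov space. -/
noncomputable def homBesovNorm {X : Type*} [MetricSpace X] [MeasurableSpace X] (μ : Measure X)
    (s p q : X → ℝ≥0∞) (u : X →ₘ[μ] ℝ) : ℝ≥0∞ :=
  ⨅ g : {g : ℤ → X → ℝ≥0∞ // IsVectorGradient s u g}, seqLpNorm μ p q g.1

/-- The Hajłasz–Triebel–Lizorkin space `M^{s(·)}_{p(·),q(·)}(X,d,μ)`. -/
def hajlaszTL {X : Type*} [MetricSpace X] [MeasurableSpace X] (μ : Measure X)
    (s p q : X → ℝ≥0∞) : Set (X →ₘ[μ] ℝ) :=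
  {u | homTLNorm μ s p q u < ∞} ∩ varLebesgue μ p

/-- The quasi-norm of `M^{s(·)}_{p(·),q(·)}(X,d,μ)`. -/
noncomputable def hajlaszTLNorm {X : Type*} [MetricSpace X] [MeasurableSpace X] (μ : Measure X)
    (s p q : X → ℝ≥0∞) (u : X →ₘ[μ] ℝ) : ℝ≥0∞ :=
  varLebesgueNorm μ p u + homTLNorm μ s p q u

/-- The Hajłasz–Besov space `N^{s(·)}_{p(·),q(·)}(X,d,μ)`. -/
def hajlaszBesov {X : Type*} [MetricSpace X] [MeasurableSpace X] (μ : Measure X)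
    (s p q : X → ℝ≥0∞) : Set (X →ₘ[μ] ℝ) :=
  {u | homBesovNorm μ s p q u < ∞} ∩ varLebesgue μ p

/-- The quasi-norm of `N^{s(·)}_{p(·),q(·)}(X,d,μ)`. -/
noncomputable def hajlaszBesovNorm {X : Type*} [MetricSpace X] [MeasurableSpace X]
    (μ : Measure X) (s p q : X → ℝ≥0∞) (u : X →ₘ[μ] ℝ) : ℝ≥0∞ :=
  varLebesgueNorm μ p u + homBesovNorm μ s p q u

/-- The compact embedding `A ↪↪ B` of quasi-normed spaces inside a common vector space `E`: `A`
is contained in `B`, the inclusion is bounded, and every sequence that is bounded in `A` has a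
subsequence that converges in `B` to an element of `B`. -/
def CompactEmbedding {E : Type*} [AddCommGroup E] (A : Set E) (normA : E → ℝ≥0∞)
    (B : Set E) (normB : E → ℝ≥0∞) : Prop :=
  A ⊆ B ∧
  (∃ C : ℝ≥0, ∀ u ∈ A, normB u ≤ C * normA u) ∧
  ∀ u : ℕ → E, (∀ n, u n ∈ A) → (∃ C : ℝ≥0, ∀ n, normA (u n) ≤ C) →
    ∃ v ∈ B, ∃ φ : ℕ → ℕ, StrictMono φ ∧
      Tendsto (fun k => normB (u (φ k) - v)) atTop (𝓝 0)

/-! All three embeddings reduce to one statement about `HajlaszPair`. If `l` exceeds the norm of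
`u`, then `f = u / l` has a single scalar gradient `H ≥ 1` whose `p(·)`-modular is bounded by a
constant independent of `u`. For Triebel–Lizorkin spaces `H` comes from `sup_k g_k`, which the `ℓ^q`
norm dominates for every `q`. For Besov spaces with `q ≤ p` it comes from the pointwise `ℓ^{p(x)}`
sum of the `g_k`, and for `t ≪ s` from the same sum with weights `2^{-δn}`, gained by lowering the
smoothness from `s` to `t`.

For pairs there are two independent estimates.

Integrability: by Chebyshev and lower regularity, a ball of suitable radius about any point contains
a point where `H` is at most a prescribed level. Chaining through such points gives the local bound
`|f| ≤ C H^(1 - s₀p₀/Q₀)` with frozen exponents (`HajlaszPair.exists_local_bound`). The exponents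
are uniformly continuous and `X` is totally bounded, so finitely many small balls suffice, and the
gap `β ≪ γ` absorbs the freezing error. Thus `∫ |f|^(β+δ)` is bounded uniformly
(`HajlaszPair.exists_lintegral_le`).

Compactness: on `{H ≤ M}` the functions are uniformly Hölder at small scales, and `{H > M}` is
uniformly small. Sampling on countably many balls and extracting a diagonal subsequence gives
convergence in measure, hence a.e. along a further subsequence
(`HajlaszPair.exists_ae_tendsto_subseq`). A Vitali argument, using the surplus `δ` in the exponent,
upgrades this to convergence in `L^{β(·)}` (`compactEmbedding_of_hajlaszPair`). -/

/-! ### Scalar Hajłasz pairs. -/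

/-- A scalar Hajłasz pair: `H ≥ 1` dominates `f`, is an `s(·)`-gradient of `f` at distances
less than `1`, and has `p(·)`-modular at most `K`. -/
structure HajlaszPair {X : Type*} [MetricSpace X] [MeasurableSpace X] (μ : Measure X)
    (s p : X → ℝ) (K : ℝ≥0∞) (f H : X → ℝ) : Prop where
  measurable : Measurable H
  one_le : ∀ x, 1 ≤ H x
  gradient : ∃ N : Set X, μ N = 0 ∧ (∀ x, x ∉ N → |f x| ≤ H x) ∧
    ∀ x y, x ∉ N → y ∉ N → dist x y < 1 →
      |f x - f y| ≤ dist x y ^ s x * H x + dist x y ^ s y * H y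
  modular_le : ∫⁻ x, ENNReal.ofReal (H x ^ p x) ∂μ ≤ K

namespace HajlaszPair

variable {X : Type*} [MetricSpace X] [MeasurableSpace X] {μ : Measure X}
  {s p : X → ℝ} {K : ℝ≥0∞} {f H : X → ℝ}

/-- The normalization `H ≥ 1` is what allows the variable exponent to be replaced by its lower bound
`p₀` on `V`. -/
theorem chebyshev (h : HajlaszPair μ s p K f H) (hp : Measurable p) {V : Set X} {p₀ : ℝ}
    (hp₀ : 0 ≤ p₀) (hV : ∀ x ∈ V, p₀ ≤ p x) {t : ℝ} (ht : 1 ≤ t) :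
    ENNReal.ofReal (t ^ p₀) * μ (V ∩ {x | t < H x}) ≤ K := by
  have hm : Measurable fun x => ENNReal.ofReal (H x ^ p x) := (h.measurable.pow hp).ennreal_ofReal
  refine le_trans ?_ ((mul_meas_ge_le_lintegral₀ hm.aemeasurable (ENNReal.ofReal (t ^ p₀))).trans
    h.modular_le)
  gcongr
  rintro x ⟨hxV, hxt⟩
  have hxt' : t < H x := hxt
  refine ENNReal.ofReal_le_ofReal ?_
  calc t ^ p₀ ≤ H x ^ p₀ := Real.rpow_le_rpow (by linarith) hxt'.le hp₀
    _ ≤ H x ^ p x := Real.rpow_le_rpow_of_exponent_le (h.one_le x) (hV x hxV)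

/-- One step of the chaining argument: near a point there are points with a smaller gradient. -/
theorem exists_mem_ball_le (h : HajlaszPair μ s p K f H) (hp : Measurable p) {x : X} {r p₀ t m : ℝ}
    (hp₀ : 0 ≤ p₀) (hpV : ∀ y ∈ Metric.ball x r, p₀ ≤ p y) (ht : 1 ≤ t) {N : Set X} (hN : μ N = 0)
    (hm : ENNReal.ofReal m ≤ μ (Metric.ball x r)) (hK : K < ENNReal.ofReal (t ^ p₀ * m)) :
    ∃ y ∈ Metric.ball x r, y ∉ N ∧ H y ≤ t := by
  by_contra! hcon
  have hsub : Metric.ball x r ⊆ N ∪ (Metric.ball x r ∩ {y | t < H y}) := by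
    intro y hy
    by_cases hyN : y ∈ N
    · exact Or.inl hyN
    · exact Or.inr ⟨hy, hcon y hy hyN⟩
  have h1 : μ (Metric.ball x r) ≤ μ (Metric.ball x r ∩ {y | t < H y}) :=
    (measure_mono hsub).trans ((measure_union_le _ _).trans (by rw [hN, zero_add]))
  have h2 := h.chebyshev hp hp₀ hpV ht
  have h3 : ENNReal.ofReal (t ^ p₀ * m) ≤ K := by
    rw [ENNReal.ofReal_mul (by positivity)]
    exact le_trans (by gcongr; exact hm.trans h1) h2
  exact absurd hK (not_lt.mpr h3)

end HajlaszPair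

/-! ### Local pointwise estimate by chaining. -/

section LocalEstimate

variable {X : Type*} [MetricSpace X] [MeasurableSpace X] {μ : Measure X} {s p : X → ℝ} {K : ℝ≥0∞}

theorem two_rpow_pow_rpow (a b : ℝ) (k : ℕ) : (((2 : ℝ) ^ a) ^ k) ^ b = 2 ^ (a * k * b) := by
  rw [Real.rpow_mul (by norm_num), Real.rpow_mul (by norm_num), Real.rpow_natCast]

theorem exists_one_le_lt_rpow_mul (hK : K ≠ ∞) {p₀ m : ℝ} (hp₀ : 0 < p₀) (hm : 0 < m) :
    ∃ t : ℝ, 1 ≤ t ∧ K < ENNReal.ofReal (t ^ p₀ * m) := by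
  have h1 : Tendsto (fun t : ℝ => t ^ p₀ * m) atTop atTop :=
    (tendsto_rpow_atTop hp₀).atTop_mul_const hm
  obtain ⟨t, ht1, ht2⟩ := ((eventually_ge_atTop (1 : ℝ)).and
    (h1.eventually_gt_atTop K.toReal)).exists
  exact ⟨t, ht1, (ENNReal.lt_ofReal_iff_toReal_lt hK).mpr ht2⟩

/-- Local pointwise Sobolev-type estimate: a function is controlled by a power smaller than one
of its Hajłasz gradient. -/
theorem HajlaszPair.exists_local_bound (hp : Measurable p) (hK : K ≠ ∞) {x₀ : X}
    {ρ b s₀ p₀ Q₀ : ℝ} (hρ : 0 < ρ) (hb : 0 < b) (hs₀ : 0 < s₀) (hp₀ : 0 < p₀) (hQ₀ : 0 < Q₀)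
    (hlt : s₀ * p₀ < Q₀)
    (hs : ∀ x ∈ Metric.ball x₀ (2 * ρ), s₀ ≤ s x) (hpV : ∀ x ∈ Metric.ball x₀ (2 * ρ), p₀ ≤ p x)
    (hreg : ∀ x ∈ Metric.ball x₀ (2 * ρ), ∀ r : ℝ, 0 < r → r ≤ 1 →
      ENNReal.ofReal (b * r ^ Q₀) ≤ μ (Metric.ball x r)) :
    ∃ C : ℝ, 1 ≤ C ∧ ∀ f H : X → ℝ, HajlaszPair μ s p K f H →
      ∀ᵐ x ∂μ, x ∈ Metric.ball x₀ ρ → |f x| ≤ C * H x ^ (1 - s₀ * p₀ / Q₀) := by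
  set α : ℝ := 1 - s₀ * p₀ / Q₀ with hα
  have hα0 : 0 < α := by rw [hα, sub_pos, div_lt_one hQ₀]; exact hlt
  -- Levels of `H` double while radii shrink by `θ`. Since `θ^Q₀ * 2^p₀ = 1`, the Chebyshev
  -- condition is the same at every scale; and `θ^s₀ * 2 = 2^α` is the growth of the oscillation per
  -- scale.
  set θ : ℝ := (2 : ℝ) ^ (-(p₀ / Q₀)) with hθ
  have hθ0 : 0 < θ := by positivity
  have hθ1 : θ < 1 := Real.rpow_lt_one_of_one_lt_of_neg (by norm_num) (by simp; positivity)
  have h1θ : 0 < 1 - θ := by linarith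
  -- The radii `R * θ^j` sum to `R / (1 - θ) ≤ ρ`, so chains starting in the ball of radius `ρ` stay
  -- in the ball of radius `2ρ`; the bound `1/2` keeps every step in the range of the gradient
  -- inequality.
  set R : ℝ := min (ρ * (1 - θ)) (1 / 2) with hR
  have hR0 : 0 < R := lt_min (by positivity) (by norm_num)
  have hR2 : R ≤ 1 / 2 := min_le_right _ _
  have hRρ : R / (1 - θ) ≤ ρ := by rw [div_le_iff₀ h1θ]; exact min_le_left _ _
  obtain ⟨l, hl1, hlK⟩ := exists_one_le_lt_rpow_mul hK hp₀ (m := b * R ^ Q₀) (by positivity)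
  have h2α : 1 < (2 : ℝ) ^ α := Real.one_lt_rpow (by norm_num) hα0
  -- `A ≥ l` starts the induction, and `A + 3l ≤ A * 2^α` closes it.
  set A : ℝ := l + 3 * l / ((2 : ℝ) ^ α - 1) with hA
  have hAl : l ≤ A := by
    have : 0 ≤ 3 * l / ((2 : ℝ) ^ α - 1) := div_nonneg (by linarith) (by linarith)
    linarith
  have hAstep : A + 3 * l ≤ A * (2 : ℝ) ^ α := by
    have h3 : 3 * l / ((2 : ℝ) ^ α - 1) * ((2 : ℝ) ^ α - 1) = 3 * l :=
      div_mul_cancel₀ _ (by linarith)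
    have h4 : 0 ≤ l * ((2 : ℝ) ^ α - 1) := mul_nonneg (by linarith) (by linarith)
    have : A * ((2 : ℝ) ^ α - 1) = l * ((2 : ℝ) ^ α - 1) + 3 * l := by rw [hA, add_mul, h3]
    linarith
  refine ⟨A * 2 ^ α, ?_, fun f H h => ?_⟩
  · nlinarith
  obtain ⟨N, hN, habs, hgrad⟩ := h.gradient
  -- Induction on the level of `H`. The allowed distance to `x₀` leaves room for the steps already
  -- made: at level `k` it is `ρ` plus the tail of the geometric series of radii from index `k` on.
  have key : ∀ (k : ℕ) (x : X), x ∉ N → dist x x₀ < ρ + R * θ ^ k / (1 - θ) → H x ≤ l * 2 ^ k →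
      |f x| ≤ A * ((2 : ℝ) ^ α) ^ k := by
    intro k
    induction k with
    | zero =>
      intro x hxN _ hx
      have := habs x hxN
      simp only [pow_zero, mul_one] at hx ⊢
      linarith
    | succ k ih =>
      intro x hxN hxd hx
      set r : ℝ := R * θ ^ k with hr
      have hθk : θ ^ k ≤ 1 := pow_le_one₀ hθ0.le hθ1.le
      have hr0 : 0 < r := by positivity
      have hrR : r ≤ R := by nlinarith
      have hsplit : R * θ ^ (k + 1) / (1 - θ) + r = R * θ ^ k / (1 - θ) := by
        rw [hr]; field_simp; ring
      have hle2 : ρ + R * θ ^ k / (1 - θ) ≤ 2 * ρ := by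
        have : R * θ ^ k / (1 - θ) ≤ R / (1 - θ) := by gcongr
        linarith
      have hballd : ∀ y ∈ Metric.ball x r, dist y x₀ < ρ + R * θ ^ k / (1 - θ) := by
        intro y hy
        have := dist_triangle y x x₀
        rw [Metric.mem_ball] at hy
        linarith
      have hballV : ∀ y ∈ Metric.ball x r, y ∈ Metric.ball x₀ (2 * ρ) := fun y hy => by
        rw [Metric.mem_ball]; linarith [hballd y hy]
      have hxV : x ∈ Metric.ball x₀ (2 * ρ) := hballV x (Metric.mem_ball_self hr0)
      have ht : 1 ≤ l * 2 ^ k := one_le_mul_of_one_le_of_one_le hl1 (one_le_pow₀ (by norm_num))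
      have hθQ : (θ ^ k) ^ Q₀ * ((2 : ℝ) ^ k) ^ p₀ = 1 := by
        have h1 : ((2 : ℝ) ^ k) ^ p₀ = 2 ^ ((k : ℝ) * p₀) := by
          rw [← Real.rpow_natCast, ← Real.rpow_mul (by norm_num)]
        rw [hθ, two_rpow_pow_rpow, h1, ← Real.rpow_add (by norm_num)]
        convert Real.rpow_zero (2 : ℝ) using 2
        field_simp
        ring
      have hKr : K < ENNReal.ofReal ((l * 2 ^ k) ^ p₀ * (b * r ^ Q₀)) := by
        have : (l * 2 ^ k) ^ p₀ * (b * r ^ Q₀) = l ^ p₀ * (b * R ^ Q₀) := by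
          rw [hr, Real.mul_rpow (by linarith) (by positivity),
            Real.mul_rpow hR0.le (by positivity)]
          linear_combination l ^ p₀ * b * R ^ Q₀ * hθQ
        rwa [this]
      obtain ⟨y, hy, hyN, hyH⟩ := h.exists_mem_ball_le hp hp₀.le
        (fun y hy => hpV y (hballV y hy)) ht hN (hreg x hxV r hr0 (by linarith)) hKr
      have hfy := ih y hyN (hballd y hy) hyH
      have hyd : dist x y < r := by rw [dist_comm]; exact hy
      have hg := hgrad x y hxN hyN (by linarith)
      have hpow : ∀ z ∈ Metric.ball x₀ (2 * ρ), dist x y ^ s z ≤ r ^ s₀ := fun z hz =>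
        (Real.rpow_le_rpow dist_nonneg hyd.le (hs₀.le.trans (hs z hz))).trans
          (Real.rpow_le_rpow_of_exponent_ge hr0 (by linarith) (hs z hz))
      have hHx := h.one_le x
      have hHy := h.one_le y
      have hrs : r ^ s₀ * 2 ^ k ≤ ((2 : ℝ) ^ α) ^ k := by
        have h1 : r ^ s₀ ≤ (θ ^ k) ^ s₀ := by
          apply Real.rpow_le_rpow hr0.le _ hs₀.le
          rw [hr]; nlinarith [pow_pos hθ0 k]
        have h2 : (θ ^ k) ^ s₀ * 2 ^ k = ((2 : ℝ) ^ α) ^ k := by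
          rw [hθ, two_rpow_pow_rpow, ← Real.rpow_natCast, ← Real.rpow_natCast,
            ← Real.rpow_mul (by norm_num), ← Real.rpow_add (by norm_num)]
          congr 1
          rw [hα]; field_simp; ring
        rw [← h2]; gcongr
      have hsum : |f x - f y| ≤ r ^ s₀ * (l * 2 ^ (k + 1)) + r ^ s₀ * (l * 2 ^ k) :=
        hg.trans (by
          gcongr
          · exact hpow x hxV
          · exact hpow y (hballV y hy))
      have hfx : |f x| ≤ |f y| + |f x - f y| := by
        have := abs_add_le (f y) (f x - f y); simpa using this
      have h5 : r ^ s₀ * (l * 2 ^ (k + 1)) + r ^ s₀ * (l * 2 ^ k)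
          ≤ 3 * l * ((2 : ℝ) ^ α) ^ k := by
        calc _ = 3 * l * (r ^ s₀ * 2 ^ k) := by ring
          _ ≤ _ := by gcongr
      have h6 : (A + 3 * l) * ((2 : ℝ) ^ α) ^ k ≤ A * ((2 : ℝ) ^ α) ^ (k + 1) := by
        rw [pow_succ', ← mul_assoc]; gcongr
      linarith
  filter_upwards [measure_eq_zero_iff_ae_notMem.mp hN] with x hxN hxB
  have hHx := h.one_le x
  -- The dyadic level of `H x`: `H x ≤ 2^k ≤ 2 * H x`, so `(2^α)^k` is comparable to `H x ^ α`.
  set k : ℕ := ⌈Real.logb 2 (H x)⌉₊ with hk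
  have hlog : 0 ≤ Real.logb 2 (H x) := Real.logb_nonneg (by norm_num) hHx
  have hk1 : H x ≤ 2 ^ k := by
    rw [← Real.rpow_natCast, ← Real.logb_le_iff_le_rpow (by norm_num) (by linarith)]
    exact Nat.le_ceil _
  have hk2 : (k : ℝ) ≤ Real.logb 2 (H x) + 1 := (Nat.ceil_lt_add_one hlog).le
  have h1 := key k x hxN (by
      rw [Metric.mem_ball] at hxB
      have : 0 < R * θ ^ k / (1 - θ) := by positivity
      linarith) (hk1.trans (le_mul_of_one_le_left (by positivity) hl1))
  have h2 : ((2 : ℝ) ^ α) ^ k ≤ 2 ^ α * H x ^ α := by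
    calc ((2 : ℝ) ^ α) ^ k = ((2 : ℝ) ^ (k : ℝ)) ^ α := by
          rw [← Real.rpow_natCast, ← Real.rpow_mul (by norm_num), ← Real.rpow_mul (by norm_num),
            mul_comm]
      _ ≤ ((2 : ℝ) ^ (Real.logb 2 (H x) + 1)) ^ α := by
          gcongr; norm_num
      _ = _ := by
          rw [Real.rpow_add (by norm_num), Real.rpow_one,
            Real.rpow_logb (by norm_num) (by norm_num) (by linarith),
            Real.mul_rpow (by linarith) (by norm_num), mul_comm]
  calc |f x| ≤ A * ((2 : ℝ) ^ α) ^ k := h1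
    _ ≤ A * (2 ^ α * H x ^ α) := by gcongr
    _ = _ := by ring

end LocalEstimate

/-! ### Almost everywhere convergent subsequences. -/

/-- A sequence that is Cauchy in measure has an almost everywhere convergent subsequence. -/
theorem exists_ae_tendsto_subseq_of_cauchy_in_measure {X : Type*} [MeasurableSpace X]
    {μ : Measure X} {f : ℕ → X → ℝ} (hf : ∀ n, Measurable (f n))
    (hc : ∀ ε : ℝ, 0 < ε → ∃ n₀, ∀ n m, n₀ ≤ n → n₀ ≤ m →
      μ {x | ε < |f n x - f m x|} ≤ ENNReal.ofReal ε) :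
    ∃ φ : ℕ → ℕ, StrictMono φ ∧ ∃ v : X → ℝ, Measurable v ∧
      ∀ᵐ x ∂μ, Tendsto (fun n => f (φ n) x) atTop (𝓝 (v x)) := by
  obtain ⟨φ, hφ, hφc⟩ := extraction_forall_of_eventually
    (P := fun j k => ∀ n m, k ≤ n → k ≤ m →
      μ {x | (1 / 2 : ℝ) ^ j < |f n x - f m x|} ≤ ENNReal.ofReal ((1 / 2 : ℝ) ^ j)) (fun j => by
    obtain ⟨n₀, h⟩ := hc ((1 / 2 : ℝ) ^ j) (by positivity)
    filter_upwards [eventually_ge_atTop n₀] with k hk n m hn hm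
    exact h n m (hk.trans hn) (hk.trans hm))
  refine ⟨φ, hφ, ?_⟩
  -- Borel–Cantelli input: almost every point lies in only finitely many of these sets, so the
  -- increments there are eventually dominated by a geometric series.
  have hsum : ∑' j, μ {x | (1 / 2 : ℝ) ^ j < |f (φ j) x - f (φ (j + 1)) x|} ≠ ∞ := by
    have h1 : ∑' j : ℕ, ENNReal.ofReal ((1 / 2 : ℝ) ^ j) ≠ ∞ := by
      rw [← ENNReal.ofReal_tsum_of_nonneg (fun j => by positivity) summable_geometric_two]
      exact ENNReal.ofReal_ne_top
    exact ne_top_of_le_ne_top h1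
      (ENNReal.tsum_le_tsum fun j => hφc j _ _ le_rfl (hφ (Nat.lt_succ_self j)).le)
  refine measurable_limit_of_tendsto_metrizable_ae (fun n => (hf (φ n)).aemeasurable) ?_
  filter_upwards [ae_eventually_notMem hsum] with x hx
  refine cauchySeq_tendsto_of_complete (cauchySeq_of_summable_dist ?_)
  refine Summable.of_norm_bounded_eventually_nat summable_geometric_two ?_
  filter_upwards [hx] with n hn
  rw [Real.norm_of_nonneg dist_nonneg, Real.dist_eq]
  exact not_lt.mp hn

/-- Uniform Hölder continuity on a sublevel set of the gradient. Two points within `2^(-(m+2))` of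
`z` are at distance at most `2^(-(m+1)) < 1`, so the gradient inequality applies and the exponents
may be lowered to `s₀`. -/
theorem abs_sub_le_pow_of_hajlasz {X : Type*} [MetricSpace X] {s f H : X → ℝ} {N : Set X} {s₀ : ℝ} (hs₀ : 0 < s₀)
    (hs : ∀ x, s₀ ≤ s x) (hH : ∀ x, 1 ≤ H x)
    (hg : ∀ x y, x ∉ N → y ∉ N → dist x y < 1 →
      |f x - f y| ≤ dist x y ^ s x * H x + dist x y ^ s y * H y) {x y z : X} (hx : x ∉ N)
    (hy : y ∉ N) {m : ℕ} (hxz : dist x z < (1 / 2 : ℝ) ^ (m + 2))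
    (hyz : dist y z < (1 / 2 : ℝ) ^ (m + 2)) {M : ℝ} (hxM : H x ≤ M) (hyM : H y ≤ M) :
    |f x - f y| ≤ ((1 / 2 : ℝ) ^ s₀) ^ (m + 1) * (2 * M) := by
  have hd : dist x y ≤ (1 / 2 : ℝ) ^ (m + 1) := by
    have := dist_triangle_right x y z
    have h2 : (1 / 2 : ℝ) ^ (m + 2) = (1 / 2 : ℝ) ^ (m + 1) / 2 := by ring
    linarith
  have hm : (1 / 2 : ℝ) ^ (m + 1) < 1 := pow_lt_one₀ (by norm_num) (by norm_num) (by simp)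
  have hpow : ∀ w, dist x y ^ s w ≤ ((1 / 2 : ℝ) ^ s₀) ^ (m + 1) := fun w => by
    calc dist x y ^ s w ≤ ((1 / 2 : ℝ) ^ (m + 1)) ^ s w :=
          Real.rpow_le_rpow dist_nonneg hd (hs₀.le.trans (hs w))
      _ ≤ ((1 / 2 : ℝ) ^ (m + 1)) ^ s₀ :=
          Real.rpow_le_rpow_of_exponent_ge (by positivity) hm.le (hs w)
      _ = _ := by
          rw [← Real.rpow_natCast, ← Real.rpow_natCast, ← Real.rpow_mul (by norm_num),
            ← Real.rpow_mul (by norm_num), mul_comm]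
  have hx1 := hH x
  have hy1 := hH y
  calc |f x - f y| ≤ _ := hg x y hx hy (by linarith)
    _ ≤ ((1 / 2 : ℝ) ^ s₀) ^ (m + 1) * M + ((1 / 2 : ℝ) ^ s₀) ^ (m + 1) * M := by
        gcongr
        · exact hpow x
        · exact hpow y
    _ = _ := by ring

namespace HajlaszPair

variable {X : Type*} [MetricSpace X] [MeasurableSpace X] {μ : Measure X}
  {s p : X → ℝ} {K : ℝ≥0∞}

/-- The point is uniformity: the level `M` serves all pairs with the same modular bound `K`. -/
theorem exists_nat_measure_le (hp : Measurable p) {p₀ : ℝ} (hp₀ : 0 < p₀) (hp₁ : ∀ x, p₀ ≤ p x)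
    (hK : K ≠ ∞) {ε : ℝ} (hε : 0 < ε) :
    ∃ M : ℕ, ∀ f H : X → ℝ, HajlaszPair μ s p K f H → μ {x | (M : ℝ) < H x} ≤ ENNReal.ofReal ε := by
  obtain ⟨t, ht1, htK⟩ := exists_one_le_lt_rpow_mul hK hp₀ hε
  refine ⟨⌈t⌉₊, fun f H h => ?_⟩
  have h1 := h.chebyshev hp hp₀.le (V := Set.univ) (fun x _ => hp₁ x) ht1
  rw [Set.univ_inter] at h1
  have h2 : ENNReal.ofReal (t ^ p₀) * μ {x | t < H x} ≤
      ENNReal.ofReal (t ^ p₀) * ENNReal.ofReal ε := by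
    rw [← ENNReal.ofReal_mul (by positivity)]
    exact h1.trans htK.le
  have h3 : μ {x | t < H x} ≤ ENNReal.ofReal ε :=
    (ENNReal.mul_le_mul_iff_right (by simp; positivity) ENNReal.ofReal_ne_top).mp h2
  refine le_trans (measure_mono ?_) h3
  intro x (hx : _ < H x)
  exact (Nat.le_ceil t).trans_lt hx

/-- Along a subsequence, the functions are pointwise Cauchy on the sets where the gradients are
bounded. -/
theorem exists_subseq_cauchy_on_sublevel [TopologicalSpace.SeparableSpace X] {s₀ : ℝ}
    (hs₀ : 0 < s₀) (hs : ∀ x, s₀ ≤ s x) {f H : ℕ → X → ℝ}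
    (h : ∀ n, HajlaszPair μ s p K (f n) (H n)) :
    ∃ φ : ℕ → ℕ, StrictMono φ ∧ ∀ᵐ x ∂μ, ∀ (M : ℕ) (ε : ℝ), 0 < ε → ∃ n₀, ∀ n m, n₀ ≤ n → n₀ ≤ m →
      H (φ n) x ≤ M → H (φ m) x ≤ M → |f (φ n) x - f (φ m) x| ≤ ε := by
  classical
  choose N hN habs hgrad using fun n => (h n).gradient
  obtain ⟨D, hDc, hDd⟩ := TopologicalSpace.exists_countable_dense X
  have : Countable D := hDc.to_subtype
  -- The index `(M, m, d)` stands for the part of the sublevel set `{H n ≤ M}` in the ball of radius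
  -- `2^(-(m+2))` about `d`. Null sets and sublevel sets vary with `n`, so the sample point is
  -- allowed to depend on `n`.
  let good : ℕ → ℕ × ℕ × D → X → Prop := fun n i y =>
    y ∉ N n ∧ H n y ≤ i.1 ∧ dist y i.2.2 < (1 / 2 : ℝ) ^ (i.2.1 + 2)
  -- The default `0` only keeps `c n` in the compact product of the intervals `[-M, M]`; it plays no
  -- role later, as the value is used only when the point `x` under study is itself good.
  let c : ℕ → ℕ × ℕ × D → ℝ := fun n i => if hy : ∃ y, good n i y then f n hy.choose else 0
  have hc : ∀ n, c n ∈ Set.univ.pi fun i : ℕ × ℕ × D => Set.Icc (-(i.1 : ℝ)) i.1 := by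
    intro n i _
    by_cases hy : ∃ y, good n i y
    · have h1 : c n i = f n hy.choose := dif_pos hy
      rw [h1]
      exact abs_le.mp <| (habs n _ hy.choose_spec.1).trans hy.choose_spec.2.1
    · have h1 : c n i = 0 := dif_neg hy
      rw [h1]; simp
  obtain ⟨a, -, φ, hφ, ha⟩ := (isCompact_univ_pi fun i : ℕ × ℕ × D =>
    isCompact_Icc (a := -(i.1 : ℝ)) (b := i.1)).tendsto_subseq hc
  refine ⟨φ, hφ, ?_⟩
  have hN' : ∀ᵐ x ∂μ, ∀ n, x ∉ N n :=
    ae_all_iff.mpr fun n => measure_eq_zero_iff_ae_notMem.mp (hN n)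
  filter_upwards [hN'] with x hx M ε hε
  have hθ1 : (1 / 2 : ℝ) ^ s₀ < 1 := Real.rpow_lt_one (by norm_num) (by norm_num) hs₀
  obtain ⟨m₀, hm₀⟩ := exists_pow_lt_of_lt_one
    (show 0 < ε / 3 / (2 * M + 1) by positivity) hθ1
  obtain ⟨d, hd, hxd⟩ := hDd.exists_dist_lt x
    (show (0 : ℝ) < (1 / 2 : ℝ) ^ (m₀ + 2) by positivity)
  have hosc : ∀ n, H n x ≤ M → |f n x - c n (M, m₀, ⟨d, hd⟩)| ≤ ε / 3 := by
    intro n hn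
    have hy : ∃ y, good n (M, m₀, ⟨d, hd⟩) y := ⟨x, hx n, hn, hxd⟩
    have h1 : c n (M, m₀, ⟨d, hd⟩) = f n hy.choose := dif_pos hy
    rw [h1]
    obtain ⟨hy1, hy2, hy3⟩ := hy.choose_spec
    refine (abs_sub_le_pow_of_hajlasz hs₀ hs (h n).one_le (hgrad n) (hx n) hy1 hxd hy3 hn hy2).trans ?_
    rw [lt_div_iff₀ (by positivity)] at hm₀
    have h2 : ((1 / 2 : ℝ) ^ s₀) ^ (m₀ + 1) ≤ ((1 / 2 : ℝ) ^ s₀) ^ m₀ :=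
      pow_le_pow_of_le_one (by positivity) hθ1.le (Nat.le_succ _)
    calc _ ≤ ((1 / 2 : ℝ) ^ s₀) ^ m₀ * (2 * M + 1) := by gcongr; linarith
      _ ≤ _ := hm₀.le
  have hci := (tendsto_pi_nhds.mp ha (M, m₀, ⟨d, hd⟩)).cauchySeq
  obtain ⟨n₀, hn₀⟩ := Metric.cauchySeq_iff.mp hci (ε / 3) (by positivity)
  refine ⟨n₀, fun n m hn hm hnM hmM => ?_⟩
  have h1 := hosc _ hnM
  have h2 := hosc _ hmM
  have h3 := hn₀ n hn m hm
  simp only [Function.comp, Real.dist_eq] at h3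
  rw [abs_le] at *
  rw [abs_lt] at h3
  constructor <;> linarith [h1.1, h1.2, h2.1, h2.2, h3.1, h3.2]

/-- Sequences of functions with uniformly bounded Hajłasz gradients have almost everywhere
convergent subsequences. -/
theorem exists_ae_tendsto_subseq [TopologicalSpace.SeparableSpace X] [IsFiniteMeasure μ]
    (hp : Measurable p) {p₀ s₀ : ℝ} (hp₀ : 0 < p₀) (hp₁ : ∀ x, p₀ ≤ p x) (hs₀ : 0 < s₀)
    (hs : ∀ x, s₀ ≤ s x) (hK : K ≠ ∞) {f H : ℕ → X → ℝ}
    (h : ∀ n, HajlaszPair μ s p K (f n) (H n)) (hf : ∀ n, Measurable (f n)) :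
    ∃ φ : ℕ → ℕ, StrictMono φ ∧ ∃ v : X → ℝ, Measurable v ∧
      ∀ᵐ x ∂μ, Tendsto (fun n => f (φ n) x) atTop (𝓝 (v x)) := by
  obtain ⟨φ, hφ, hcau⟩ := exists_subseq_cauchy_on_sublevel hs₀ hs h
  suffices hc : ∀ ε : ℝ, 0 < ε → ∃ n₀, ∀ n m, n₀ ≤ n → n₀ ≤ m →
      μ {x | ε < |f (φ n) x - f (φ m) x|} ≤ ENNReal.ofReal ε by
    obtain ⟨ψ, hψ, v, hv, hlim⟩ :=
      exists_ae_tendsto_subseq_of_cauchy_in_measure (fun n => hf (φ n)) hc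
    exact ⟨φ ∘ ψ, hφ.comp hψ, v, hv, hlim⟩
  intro ε hε
  obtain ⟨M, hM⟩ := exists_nat_measure_le (μ := μ) (s := s) hp hp₀ hp₁ hK
    (show 0 < ε / 3 by positivity)
  -- The points of failure of the Cauchy property beyond `n₀` on the sublevel set. They decrease to
  -- a null set, so their measures tend to `0` by finiteness of `μ`.
  let F : ℕ → Set X := fun n₀ => ⋃ n, ⋃ m, ⋃ (_ : n₀ ≤ n), ⋃ (_ : n₀ ≤ m),
    {x | H (φ n) x ≤ M ∧ H (φ m) x ≤ M ∧ ε < |f (φ n) x - f (φ m) x|}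
  have hFmem : ∀ n₀ x, x ∈ F n₀ ↔ ∃ n m, n₀ ≤ n ∧ n₀ ≤ m ∧
      H (φ n) x ≤ M ∧ H (φ m) x ≤ M ∧ ε < |f (φ n) x - f (φ m) x| := by
    intro n₀ x
    simp only [F, Set.mem_iUnion, Set.mem_ofPred_eq, exists_prop]
  have hFmeas : ∀ n₀, MeasurableSet (F n₀) := fun n₀ =>
    MeasurableSet.iUnion fun n => MeasurableSet.iUnion fun m => MeasurableSet.iUnion fun _ =>
      MeasurableSet.iUnion fun _ => by
        have m1 := fun k => measurableSet_le (h (φ k)).measurable (measurable_const (a := (M : ℝ)))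
        have m2 : MeasurableSet {x | ε < |f (φ n) x - f (φ m) x|} := measurableSet_lt
          measurable_const (continuous_abs.measurable.comp ((hf _).sub (hf _)))
        exact (m1 n).inter ((m1 m).inter m2)
  have hFanti : Antitone F := by
    intro i j hij x hx
    rw [hFmem] at hx ⊢
    obtain ⟨n, m, hn, hm, hr⟩ := hx
    exact ⟨n, m, hij.trans hn, hij.trans hm, hr⟩
  have hFzero : μ (⋂ n, F n) = 0 := by
    rw [measure_eq_zero_iff_ae_notMem]
    filter_upwards [hcau] with x hx hxF
    obtain ⟨n₀, hn₀⟩ := hx M ε hε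
    obtain ⟨n, m, hn, hm, h1, h2, h3⟩ := (hFmem n₀ x).mp (Set.mem_iInter.mp hxF n₀)
    exact absurd h3 (not_lt.mpr (hn₀ n m hn hm h1 h2))
  have hFlim := tendsto_measure_iInter_atTop (fun n => (hFmeas n).nullMeasurableSet) hFanti
    ⟨0, measure_ne_top μ _⟩
  rw [hFzero] at hFlim
  obtain ⟨n₀, hn₀⟩ := (hFlim.eventually_lt_const
    (show 0 < ENNReal.ofReal (ε / 3) by simpa using hε)).exists
  refine ⟨n₀, fun n m hn hm => ?_⟩
  have hsub : {x | ε < |f (φ n) x - f (φ m) x|} ⊆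
      ({x | (M : ℝ) < H (φ n) x} ∪ {x | (M : ℝ) < H (φ m) x}) ∪ F n₀ := by
    intro x hx
    by_cases h1 : (M : ℝ) < H (φ n) x
    · exact Or.inl (Or.inl h1)
    by_cases h2 : (M : ℝ) < H (φ m) x
    · exact Or.inl (Or.inr h2)
    exact Or.inr ((hFmem n₀ x).mpr ⟨n, m, hn, hm, not_lt.mp h1, not_lt.mp h2, hx⟩)
  calc μ {x | ε < |f (φ n) x - f (φ m) x|}
      ≤ (ENNReal.ofReal (ε / 3) + ENNReal.ofReal (ε / 3)) + ENNReal.ofReal (ε / 3) :=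
        (measure_mono hsub).trans ((measure_union_le _ _).trans (add_le_add
          ((measure_union_le _ _).trans (add_le_add (hM _ _ (h _)) (hM _ _ (h _)))) hn₀.le))
    _ = ENNReal.ofReal ε := by
        rw [← ENNReal.ofReal_add (by positivity) (by positivity),
          ← ENNReal.ofReal_add (by positivity) (by positivity)]
        congr 1; ring

end HajlaszPair

/-! ### From almost everywhere convergence to convergence in the modular. -/

/-- Where `w` exceeds `M`, the factor `w^δ ≥ M^δ` pays for the truncation: the tail is controlled by
the larger exponent with a small constant. -/
theorem ENNReal.rpow_le_min_rpow_add (w : ℝ≥0∞) {M b δ : ℝ} (hM : 0 < M) (hb : 0 ≤ b)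
    (hδ : 0 ≤ δ) :
    w ^ b ≤ min w (ENNReal.ofReal M) ^ b + (ENNReal.ofReal M ^ δ)⁻¹ * w ^ (b + δ) := by
  rcases le_total w (ENNReal.ofReal M) with h | h
  · rw [min_eq_left h]; exact le_self_add
  · refine le_add_left ?_
    have h0 : ENNReal.ofReal M ^ δ ≠ 0 :=
      (ENNReal.rpow_pos (by simpa using hM) ENNReal.ofReal_ne_top).ne'
    have h1 : ENNReal.ofReal M ^ δ ≠ ∞ := ENNReal.rpow_ne_top_of_nonneg hδ ENNReal.ofReal_ne_top
    calc w ^ b = (ENNReal.ofReal M ^ δ)⁻¹ * (w ^ b * ENNReal.ofReal M ^ δ) := by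
          rw [mul_comm (w ^ b), ← mul_assoc, ENNReal.inv_mul_cancel h0 h1, one_mul]
      _ ≤ (ENNReal.ofReal M ^ δ)⁻¹ * (w ^ b * w ^ δ) := by gcongr
      _ = _ := by rw [ENNReal.rpow_add_of_nonneg _ _ hb hδ]

theorem ENNReal.add_rpow_le_two_rpow_mul (a b : ℝ≥0∞) {r : ℝ} (hr : 0 ≤ r) :
    (a + b) ^ r ≤ 2 ^ r * (a ^ r + b ^ r) := by
  calc (a + b) ^ r ≤ (2 * max a b) ^ r := by
        gcongr
        rw [two_mul]
        exact add_le_add (le_max_left _ _) (le_max_right _ _)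
    _ = 2 ^ r * max a b ^ r := ENNReal.mul_rpow_of_nonneg _ _ hr
    _ ≤ _ := by
        gcongr
        rcases le_total a b with h | h
        · rw [max_eq_right h]; exact le_add_self
        · rw [max_eq_left h]; exact le_self_add

section Vitali

variable {X : Type*} [MeasurableSpace X] {μ : Measure X}

/-- A form of Vitali's convergence theorem for variable exponents. -/
theorem eventually_lintegral_rpow_le_one [IsFiniteMeasure μ] {b : X → ℝ} (hb : Measurable b) {δ B : ℝ} (hδ : 0 < δ)
    (hb₀ : ∀ᵐ x ∂μ, 0 < b x) (hbB : ∀ᵐ x ∂μ, b x ≤ B) {w : ℕ → X → ℝ≥0∞}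
    (hw : ∀ n, Measurable (w n)) (hlim : ∀ᵐ x ∂μ, Tendsto (fun n => w n x) atTop (𝓝 0))
    {C : ℝ≥0∞} (hC : C ≠ ∞) (hwC : ∀ n, ∫⁻ x, w n x ^ (b x + δ) ∂μ ≤ C) :
    ∀ᶠ n in atTop, ∫⁻ x, w n x ^ b x ∂μ ≤ 1 := by
  -- This `M` makes the tail at most `1/2`; the truncated part tends to `0` by dominated convergence
  -- and is eventually below `1/2`.
  obtain ⟨M, hM1, hMC⟩ : ∃ M : ℝ, 1 ≤ M ∧ 2 * C < ENNReal.ofReal (M ^ δ * 1) :=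
    exists_one_le_lt_rpow_mul (ENNReal.mul_ne_top (by simp) hC) hδ one_pos
  have hM0 : 0 < M := by linarith
  have hMδ : ENNReal.ofReal M ^ δ = ENNReal.ofReal (M ^ δ) := ENNReal.ofReal_rpow_of_pos hM0
  have htail : (ENNReal.ofReal M ^ δ)⁻¹ * C ≤ 1 / 2 := by
    rw [hMδ, mul_comm, ← div_eq_mul_inv]
    refine ENNReal.div_le_of_le_mul' ?_
    rw [mul_one] at hMC
    calc C = 2 * C * (1 / 2) := by
          rw [mul_comm 2 C, mul_assoc, one_div, ENNReal.mul_inv_cancel (by simp) (by simp), mul_one]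
      _ ≤ _ := by gcongr
  have hdom : Tendsto (fun n => ∫⁻ x, min (w n x) (ENNReal.ofReal M) ^ b x ∂μ) atTop
      (𝓝 (∫⁻ _, 0 ∂μ)) := by
    refine tendsto_lintegral_of_dominated_convergence' (fun _ => ENNReal.ofReal M ^ B)
      (fun n => (((hw n).min measurable_const).pow hb).aemeasurable) (fun n => ?_) ?_ ?_
    · filter_upwards [hb₀, hbB] with x h0 hB
      calc min (w n x) (ENNReal.ofReal M) ^ b x ≤ ENNReal.ofReal M ^ b x := by
            gcongr; exact min_le_right _ _
        _ ≤ _ := ENNReal.rpow_le_rpow_of_exponent_le (by simpa using hM1) hB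
    · rw [lintegral_const]
      refine ENNReal.mul_ne_top ?_ (measure_ne_top μ _)
      rw [ENNReal.ofReal_rpow_of_pos hM0]; exact ENNReal.ofReal_ne_top
    · filter_upwards [hlim, hb₀] with x hx h0
      have h1 : Tendsto (fun n => min (w n x) (ENNReal.ofReal M)) atTop (𝓝 0) :=
        tendsto_of_tendsto_of_tendsto_of_le_of_le tendsto_const_nhds hx
          (fun _ => bot_le) (fun _ => min_le_left _ _)
      have h2 := ((ENNReal.continuous_rpow_const (y := b x)).tendsto 0).comp h1
      rwa [ENNReal.zero_rpow_of_pos h0] at h2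
  rw [lintegral_zero] at hdom
  filter_upwards [hdom.eventually_lt_const (show (0 : ℝ≥0∞) < 1 / 2 by simp)] with n hn
  calc ∫⁻ x, w n x ^ b x ∂μ
      ≤ ∫⁻ x, (min (w n x) (ENNReal.ofReal M) ^ b x
          + (ENNReal.ofReal M ^ δ)⁻¹ * w n x ^ (b x + δ)) ∂μ := by
        refine lintegral_mono_ae ?_
        filter_upwards [hb₀] with x h0
        exact ENNReal.rpow_le_min_rpow_add _ hM0 h0.le hδ.le
    _ = ∫⁻ x, min (w n x) (ENNReal.ofReal M) ^ b x ∂μ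
          + (ENNReal.ofReal M ^ δ)⁻¹ * ∫⁻ x, w n x ^ (b x + δ) ∂μ := by
        rw [lintegral_add_left (((hw n).min measurable_const).pow hb),
          lintegral_const_mul _ ((hw n).pow (hb.add_const δ))]
    _ ≤ 1 / 2 + 1 / 2 := by
        refine add_le_add hn.le (le_trans ?_ htail)
        gcongr
        exact hwC n
    _ = 1 := ENNReal.add_halves 1

/-- Fatou's lemma: the limit inherits the uniform modular bound. -/
theorem lintegral_rpow_le_of_tendsto {b : X → ℝ} (hb : Measurable b) {f : ℕ → X → ℝ}
    (hf : ∀ n, Measurable (f n)) {v : X → ℝ}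
    (hlim : ∀ᵐ x ∂μ, Tendsto (fun n => f n x) atTop (𝓝 (v x))) {C : ℝ≥0∞}
    (hC : ∀ n, ∫⁻ x, ‖f n x‖ₑ ^ b x ∂μ ≤ C) : ∫⁻ x, ‖v x‖ₑ ^ b x ∂μ ≤ C := by
  calc ∫⁻ x, ‖v x‖ₑ ^ b x ∂μ = ∫⁻ x, liminf (fun n => ‖f n x‖ₑ ^ b x) atTop ∂μ := by
        refine lintegral_congr_ae ?_
        filter_upwards [hlim] with x hx
        exact (((ENNReal.continuous_rpow_const (y := b x)).tendsto _).comp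
          hx.enorm).liminf_eq.symm
    _ ≤ liminf (fun n => ∫⁻ x, ‖f n x‖ₑ ^ b x ∂μ) atTop :=
        lintegral_liminf_le' fun n => ((hf n).enorm.pow hb).aemeasurable
    _ ≤ C := by
        refine liminf_le_of_frequently_le' (Frequently.of_forall hC)

/-- Almost everywhere convergence together with a modular bound for a larger exponent gives
convergence in the modular sense, at every scale. -/
theorem eventually_lintegral_sub_rpow_le_one [IsFiniteMeasure μ] {b : X → ℝ} (hb : Measurable b) {δ B : ℝ}
    (hδ : 0 < δ) (hb₀ : ∀ᵐ x ∂μ, 0 < b x) (hbB : ∀ᵐ x ∂μ, b x ≤ B) {f : ℕ → X → ℝ}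
    (hf : ∀ n, Measurable (f n)) {v : X → ℝ} (hv : Measurable v)
    (hlim : ∀ᵐ x ∂μ, Tendsto (fun n => f n x) atTop (𝓝 (v x))) {C : ℝ≥0∞} (hC : C ≠ ∞)
    (hfC : ∀ n, ∫⁻ x, ‖f n x‖ₑ ^ (b x + δ) ∂μ ≤ C) {a : ℝ≥0∞} (ha₁ : 1 ≤ a) (ha : a ≠ ∞) :
    ∀ᶠ n in atTop, ∫⁻ x, (a * ‖f n x - v x‖ₑ) ^ b x ∂μ ≤ 1 := by
  have hbδ : ∀ᵐ x ∂μ, 0 < b x + δ := by filter_upwards [hb₀] with x hx using by linarith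
  have hvC := lintegral_rpow_le_of_tendsto (hb.add_const δ) hf hlim hfC
  refine eventually_lintegral_rpow_le_one hb hδ hb₀ hbB
    (fun n => measurable_const.mul ((hf n).sub hv).enorm) ?_
    (C := (a * 2) ^ (B + δ) * (C + C)) ?_ (fun n => ?_)
  · filter_upwards [hlim] with x hx
    have h1 : Tendsto (fun n => ‖f n x - v x‖ₑ) atTop (𝓝 0) := by
      have := (hx.sub_const (v x)).enorm
      rwa [sub_self, enorm_zero] at this
    have h2 := ENNReal.Tendsto.const_mul h1 (Or.inr ha)
    rwa [mul_zero] at h2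
  · refine ENNReal.mul_ne_top ?_ (ENNReal.add_ne_top.mpr ⟨hC, hC⟩)
    rcases le_total 0 (B + δ) with h | h
    · exact ENNReal.rpow_ne_top_of_nonneg h (ENNReal.mul_ne_top ha (by simp))
    · exact ENNReal.rpow_ne_top_of_ne_zero (by simp [(zero_lt_one.trans_le ha₁).ne'])
        (ENNReal.mul_ne_top ha (by simp))
  · calc ∫⁻ x, (a * ‖f n x - v x‖ₑ) ^ (b x + δ) ∂μ
        ≤ ∫⁻ x, (a * 2) ^ (B + δ) * (‖f n x‖ₑ ^ (b x + δ) + ‖v x‖ₑ ^ (b x + δ)) ∂μ := by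
          refine lintegral_mono_ae ?_
          filter_upwards [hbδ, hbB] with x h0 hB
          have h1 : ‖f n x - v x‖ₑ ≤ ‖f n x‖ₑ + ‖v x‖ₑ := enorm_sub_le
          calc (a * ‖f n x - v x‖ₑ) ^ (b x + δ)
              ≤ (a * (‖f n x‖ₑ + ‖v x‖ₑ)) ^ (b x + δ) := by gcongr
            _ = a ^ (b x + δ) * (‖f n x‖ₑ + ‖v x‖ₑ) ^ (b x + δ) :=
                ENNReal.mul_rpow_of_nonneg _ _ h0.le
            _ ≤ a ^ (b x + δ) * (2 ^ (b x + δ) * (‖f n x‖ₑ ^ (b x + δ) + ‖v x‖ₑ ^ (b x + δ))) := by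
                gcongr; exact ENNReal.add_rpow_le_two_rpow_mul _ _ h0.le
            _ = (a * 2) ^ (b x + δ) * (‖f n x‖ₑ ^ (b x + δ) + ‖v x‖ₑ ^ (b x + δ)) := by
                rw [ENNReal.mul_rpow_of_nonneg _ _ h0.le, mul_assoc]
            _ ≤ _ := by
                gcongr
                exact one_le_mul ha₁ (by norm_num)
      _ = (a * 2) ^ (B + δ) * (∫⁻ x, ‖f n x‖ₑ ^ (b x + δ) ∂μ + ∫⁻ x, ‖v x‖ₑ ^ (b x + δ) ∂μ) := by
          have hm : Measurable fun x => ‖f n x‖ₑ ^ (b x + δ) + ‖v x‖ₑ ^ (b x + δ) :=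
            ((hf n).enorm.pow (hb.add_const δ)).add (hv.enorm.pow (hb.add_const δ))
          rw [lintegral_const_mul _ hm, lintegral_add_left ((hf n).enorm.pow (hb.add_const δ))]
      _ ≤ _ := by gcongr; exact hfC n

end Vitali

/-! ### Regularity and bounds of the exponents. -/

/-- The modulus `C / log(e + 1/d)` tends to `0` with `d`; for `d < exp(-2C/ε)` it is at most `ε/2`.
Log-Hölder continuity enters the proof only in this form. -/
theorem LocLogHolder.uniformContinuous {X : Type*} [MetricSpace X] {f : X → ℝ}
    (hf : LocLogHolder f) : UniformContinuous f := by
  obtain ⟨C, hC, h⟩ := hf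
  refine Metric.uniformContinuous_iff.mpr fun ε hε => ⟨Real.exp (-(2 * C / ε)), Real.exp_pos _, ?_⟩
  intro x y hxy
  rcases eq_or_ne x y with rfl | hne
  · simpa using hε
  have hd : 0 < dist x y := dist_pos.mpr hne
  rw [Real.dist_eq]
  have h1 : 2 * C / ε ≤ Real.log (Real.exp 1 + 1 / dist x y) := by
    rw [Real.le_log_iff_exp_le (by positivity)]
    have h2 : Real.exp (2 * C / ε) ≤ 1 / dist x y := by
      rw [le_div_iff₀ hd]
      calc Real.exp (2 * C / ε) * dist x y ≤ Real.exp (2 * C / ε) * Real.exp (-(2 * C / ε)) := by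
            gcongr
        _ = 1 := by rw [← Real.exp_add]; simp
    linarith [Real.exp_pos 1]
  have h3 : 0 < 2 * C / ε := by positivity
  calc |f x - f y| ≤ C / Real.log (Real.exp 1 + 1 / dist x y) := h x y
    _ ≤ C / (2 * C / ε) := by gcongr
    _ = ε / 2 := by field_simp
    _ < ε := by linarith

section Exponents

variable {X : Type*} [MeasurableSpace X] {μ : Measure X} {p : X → ℝ≥0∞}

theorem VarExponent.exists_ae_ge (hp : VarExponent μ p) :
    ∃ a : ℝ≥0, 0 < a ∧ ∀ᵐ x ∂μ, (a : ℝ≥0∞) ≤ p x := by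
  obtain ⟨a, ha0, ha⟩ := ENNReal.lt_iff_exists_nnreal_btwn.mp hp.essInf_pos
  refine ⟨a, by simpa using ha0, ?_⟩
  filter_upwards [ae_essInf_le (f := p) (μ := μ)] with x hx using ha.le.trans hx

theorem BddVarExponent.exists_ae_le (hp : BddVarExponent μ p) :
    ∃ b : ℝ≥0, 0 < b ∧ ∀ᵐ x ∂μ, p x ≤ b := by
  refine ⟨(essSup p μ).toNNReal + 1, by positivity, ?_⟩
  filter_upwards [ae_le_essSup (f := p) (μ := μ)] with x hx
  rw [ENNReal.coe_add, ENNReal.coe_toNNReal hp.essSup_lt_top.ne]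
  exact hx.trans le_self_add

theorem StrictlyBelow.exists_ae_add_le {p₁ p₂ : X → ℝ≥0∞} (h : StrictlyBelow μ p₁ p₂) :
    ∃ c : ℝ≥0, 0 < c ∧ ∀ᵐ x ∂μ, p₁ x + c ≤ p₂ x := by
  obtain ⟨c, hc0, hc⟩ := ENNReal.lt_iff_exists_nnreal_btwn.mp h
  refine ⟨c, by simpa using hc0, ?_⟩
  filter_upwards [ae_essInf_le (f := fun x => p₂ x - p₁ x) (μ := μ)] with x hx
  have h1 : (c : ℝ≥0∞) ≤ p₂ x - p₁ x := hc.le.trans hx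
  have h2 : p₁ x ≤ p₂ x := by
    by_contra hcon
    rw [tsub_eq_zero_of_le (not_le.mp hcon).le] at h1
    exact absurd h1 (not_le.mpr hc0)
  calc p₁ x + c ≤ p₁ x + (p₂ x - p₁ x) := by gcongr
    _ = p₂ x := add_tsub_cancel_of_le h2

end Exponents

/-- The a.e. bounds on `1/p` hold everywhere, because `1/p` is continuous and sets of full measure
are dense. The positive lower bound also excludes `p = ∞`, for which `1/p` reads `0`. Uniform
continuity passes to `p` through `p - p' = -p p' (1/p - 1/p')`. -/
theorem BddLogExponent.exists_bounds {X : Type*} [MetricSpace X] [MeasurableSpace X]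
    {μ : Measure X} [μ.IsOpenPosMeasure] {p : X → ℝ≥0∞} (hp : BddLogExponent μ p) :
    ∃ a b : ℝ, 0 < a ∧ (∀ x, p x ≠ ∞ ∧ a ≤ (p x).toReal ∧ (p x).toReal ≤ b) ∧
      UniformContinuous fun x => (p x).toReal := by
  have huc := hp.logHolder.uniformContinuous
  obtain ⟨a, ha0, ha⟩ := hp.exists_ae_ge
  obtain ⟨b, hb0, hb⟩ := hp.toBddVarExponent.exists_ae_le
  have hae : ∀ᵐ x ∂μ, ((p x)⁻¹).toReal ∈ Set.Icc (b : ℝ)⁻¹ (a : ℝ)⁻¹ := by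
    filter_upwards [ha, hb] with x hxa hxb
    have hpx : 0 < (p x).toReal :=
      ENNReal.toReal_pos (hp.ne_zero x) (ne_top_of_le_ne_top ENNReal.coe_ne_top hxb)
    rw [ENNReal.toReal_inv]
    refine ⟨inv_anti₀ hpx (ENNReal.toReal_le_of_le_ofReal b.2 (by simpa using hxb)),
      inv_anti₀ ha0 ?_⟩
    exact (ENNReal.ofReal_le_iff_le_toReal (ne_top_of_le_ne_top ENNReal.coe_ne_top hxb)).mp
      (by simpa using hxa)
  have hall : ∀ x, ((p x)⁻¹).toReal ∈ Set.Icc (b : ℝ)⁻¹ (a : ℝ)⁻¹ := by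
    have hcl : IsClosed {x | ((p x)⁻¹).toReal ∈ Set.Icc (b : ℝ)⁻¹ (a : ℝ)⁻¹} :=
      isClosed_Icc.preimage huc.continuous
    intro x
    have := (Measure.dense_of_ae hae).closure_eq
    rw [hcl.closure_eq] at this
    exact (this ▸ Set.mem_univ x : x ∈ {x | ((p x)⁻¹).toReal ∈ Set.Icc (b : ℝ)⁻¹ (a : ℝ)⁻¹})
  have ha0' : (0 : ℝ) < a := ha0
  have hb0' : (0 : ℝ) < b := hb0
  have hbd : ∀ x, p x ≠ ∞ ∧ (a : ℝ) ≤ (p x).toReal ∧ (p x).toReal ≤ b := by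
    intro x
    obtain ⟨h1, h2⟩ := hall x
    have hi : 0 < ((p x)⁻¹).toReal := (inv_pos.mpr hb0').trans_le h1
    have htop : p x ≠ ∞ := by
      intro h; rw [h] at hi; simp at hi
    have hpx : 0 < (p x).toReal := ENNReal.toReal_pos (hp.ne_zero x) htop
    rw [ENNReal.toReal_inv] at h1 h2
    exact ⟨htop, (inv_le_inv₀ hpx ha0').mp h2, (inv_le_inv₀ hb0' hpx).mp h1⟩
  refine ⟨a, b, ha0, hbd, ?_⟩
  rw [Metric.uniformContinuous_iff] at huc ⊢
  intro ε hε
  obtain ⟨δ, hδ, h⟩ := huc (ε / (b * b)) (by positivity)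
  refine ⟨δ, hδ, fun x y hxy => ?_⟩
  have h1 := h hxy
  simp only [Real.dist_eq, ENNReal.toReal_inv] at h1 ⊢
  obtain ⟨-, hxa, hxb⟩ := hbd x
  obtain ⟨-, hya, hyb⟩ := hbd y
  have hx0 : 0 < (p x).toReal := ha0'.trans_le hxa
  have hy0 : 0 < (p y).toReal := ha0'.trans_le hya
  have h2 : (p x).toReal - (p y).toReal =
      -((p x).toReal * (p y).toReal * ((p x).toReal⁻¹ - (p y).toReal⁻¹)) := by
    field_simp; ring
  rw [h2, abs_neg, abs_mul, abs_of_pos (mul_pos hx0 hy0)]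
  rw [lt_div_iff₀ (by positivity)] at h1
  calc (p x).toReal * (p y).toReal * |(p x).toReal⁻¹ - (p y).toReal⁻¹|
      ≤ (b * b) * |(p x).toReal⁻¹ - (p y).toReal⁻¹| := by gcongr
    _ = |(p x).toReal⁻¹ - (p y).toReal⁻¹| * (b * b) := mul_comm _ _
    _ < ε := h1

/-! ### Uniform subcritical integrability. -/

/-- Subcritical Sobolev embedding for scalar Hajłasz pairs on a totally bounded space. -/
theorem HajlaszPair.exists_lintegral_le {X : Type*} [MetricSpace X] [MeasurableSpace X]
    {μ : Measure X} (htb : TotallyBounded (Set.univ : Set X)) {s p Q β : X → ℝ}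
    {a M B b c : ℝ} (ha : 0 < a) (hb : 0 < b) (hc : 0 < c)
    (hp : Measurable p) (hpc : UniformContinuous p) (hsc : UniformContinuous s)
    (hQc : UniformContinuous Q) (hpa : ∀ x, a ≤ p x) (hpM : ∀ x, p x ≤ M) (hsa : ∀ x, a ≤ s x)
    (hsM : ∀ x, s x ≤ M) (hQa : ∀ x, a ≤ Q x)
    (hreg : ∀ (x : X) (r : ℝ), 0 < r → r ≤ 1 → ENNReal.ofReal (b * r ^ Q x) ≤ μ (Metric.ball x r))
    (hsp : ∀ x, s x * p x + c ≤ Q x)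
    (hβ : ∀ᵐ x ∂μ, 0 ≤ β x ∧ β x ≤ B ∧ (β x + c) * (Q x - s x * p x) ≤ Q x * p x)
    {K : ℝ≥0∞} (hK : K ≠ ∞) :
    ∃ C : ℝ≥0∞, C ≠ ∞ ∧ ∀ f H : X → ℝ, HajlaszPair μ s p K f H →
      ∫⁻ x, ‖f x‖ₑ ^ (β x + c / 2) ∂μ ≤ C := by
  rcases isEmpty_or_nonempty X with hX | ⟨⟨z⟩⟩
  · exact ⟨0, by simp, fun f H _ => by simp [Measure.eq_zero_of_isEmpty μ]⟩
  have hM : 0 < M := ha.trans_le ((hpa z).trans (hpM z))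
  wlog hB : 0 ≤ B generalizing B
  · exact this (B := 0) (by
      filter_upwards [hβ] with x hx
      exact absurd (hx.1.trans hx.2.1) hB) le_rfl
  -- Freezing the exponents up to `ε` raises `Q - s p` by at most `2ε(1 + 2M)`. Multiplied by `B +
  -- c` this must stay below `c²/2`, the reserve left by asking for `β + c/2` instead of `β + c`.
  obtain ⟨ε, hε, hεa, hεc⟩ : ∃ ε : ℝ, 0 < ε ∧ ε ≤ a / 2 ∧
      2 * ε * (1 + 2 * M) * (B + c) ≤ c * c / 2 := by
    refine ⟨min (a / 2) (c * c / (4 * (1 + 2 * M) * (B + c))), by positivity, min_le_left _ _, ?_⟩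
    have h1 := min_le_right (a / 2) (c * c / (4 * (1 + 2 * M) * (B + c)))
    rw [le_div_iff₀ (by positivity)] at h1
    linarith
  obtain ⟨δ₁, hδ₁, h₁⟩ := Metric.uniformContinuous_iff.mp hpc ε hε
  obtain ⟨δ₂, hδ₂, h₂⟩ := Metric.uniformContinuous_iff.mp hsc ε hε
  obtain ⟨δ₃, hδ₃, h₃⟩ := Metric.uniformContinuous_iff.mp hQc ε hε
  obtain ⟨ρ, hρ, hρ₁, hρ₂, hρ₃⟩ : ∃ ρ : ℝ, 0 < ρ ∧ 2 * ρ ≤ δ₁ ∧ 2 * ρ ≤ δ₂ ∧ 2 * ρ ≤ δ₃ := by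
    refine ⟨min (min δ₁ δ₂) δ₃ / 2, by positivity, ?_, ?_, ?_⟩ <;> rw [mul_div_cancel₀ _ two_ne_zero]
    · exact (min_le_left _ _).trans (min_le_left _ _)
    · exact (min_le_left _ _).trans (min_le_right _ _)
    · exact min_le_right _ _
  have hnear : ∀ x₀, ∀ x ∈ Metric.ball x₀ (2 * ρ),
      |p x - p x₀| < ε ∧ |s x - s x₀| < ε ∧ |Q x - Q x₀| < ε := fun x₀ x hx =>
    ⟨h₁ (lt_of_lt_of_le hx hρ₁), h₂ (lt_of_lt_of_le hx hρ₂), h₃ (lt_of_lt_of_le hx hρ₃)⟩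
  -- On the ball of radius `2ρ` the frozen values are safe one-sided bounds: `s` and `p` are
  -- lowered, `Q` is raised.
  have hloc := fun x₀ : X => HajlaszPair.exists_local_bound (μ := μ) (s := s) hp hK (x₀ := x₀)
    (b := b) (s₀ := s x₀ - ε) (p₀ := p x₀ - ε) (Q₀ := Q x₀ + ε) hρ hb
    (by linarith [hsa x₀]) (by linarith [hpa x₀]) (by linarith [hQa x₀])
    (by nlinarith [hsp x₀, hsa x₀, hpa x₀])
    (fun x hx => by linarith [(abs_lt.mp (hnear x₀ x hx).2.1).1])
    (fun x hx => by linarith [(abs_lt.mp (hnear x₀ x hx).1).1])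
    (fun x hx r hr0 hr1 => by
      refine le_trans (ENNReal.ofReal_le_ofReal ?_) (hreg x r hr0 hr1)
      have := (abs_lt.mp (hnear x₀ x hx).2.2).2
      exact mul_le_mul_of_nonneg_left
        (Real.rpow_le_rpow_of_exponent_ge hr0 hr1 (by linarith)) hb.le)
  choose D hD1 hD using hloc
  obtain ⟨t, htf, ht⟩ := Metric.totallyBounded_iff.mp htb ρ hρ
  obtain ⟨D', hD'⟩ := (htf.image D).bddAbove
  set E := max D' 1 with hE
  have hE1 : 1 ≤ E := le_max_right _ _
  refine ⟨ENNReal.ofReal (E ^ (B + c)) * K, ENNReal.mul_ne_top ENNReal.ofReal_ne_top hK, ?_⟩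
  intro f H h
  have hae : ∀ᵐ x ∂μ, ∀ x₀ ∈ t, x ∈ Metric.ball x₀ ρ →
      |f x| ≤ D x₀ * H x ^ (1 - (s x₀ - ε) * (p x₀ - ε) / (Q x₀ + ε)) :=
    (ae_ball_iff htf.countable).mpr fun x₀ _ => hD x₀ f H h
  have hpt : ∀ᵐ x ∂μ, ‖f x‖ₑ ^ (β x + c / 2) ≤
      ENNReal.ofReal (E ^ (B + c)) * ENNReal.ofReal (H x ^ p x) := by
    filter_upwards [hae, hβ] with x hx ⟨hβ0, hβB, hβγ⟩
    obtain ⟨x₀, hx₀, hxx₀⟩ : ∃ x₀ ∈ t, x ∈ Metric.ball x₀ ρ := by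
      simpa using ht (Set.mem_univ x)
    have hfx := hx x₀ hx₀ hxx₀
    obtain ⟨hn1, hn2, hn3⟩ := hnear x₀ x (Metric.ball_subset_ball (by linarith) hxx₀)
    rw [abs_lt] at hn1 hn2 hn3
    have hHx := h.one_le x
    set s₀ := s x₀ - ε with hs₀
    set p₀ := p x₀ - ε with hp₀
    set Q₀ := Q x₀ + ε with hQ₀
    have hs₀0 : 0 < s₀ := by linarith [hsa x₀]
    have hp₀0 : 0 < p₀ := by linarith [hpa x₀]
    have hQ₀0 : 0 < Q₀ := by linarith [hQa x₀]
    have hprod : s x * p x - 2 * ε * (2 * M) ≤ s₀ * p₀ := by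
      have e1 : s x - 2 * ε ≤ s₀ := by linarith
      have e2 : p x - 2 * ε ≤ p₀ := by linarith
      have e3 : p₀ ≤ M := by linarith [hpM x₀]
      have e4 : (s x - 2 * ε) * p₀ ≤ s₀ * p₀ := by gcongr
      have e5 : s x * (p x - 2 * ε) ≤ s x * p₀ :=
        mul_le_mul_of_nonneg_left e2 (ha.le.trans (hsa x))
      have e6 : ε * p₀ ≤ ε * M := by gcongr
      have e7 : ε * s x ≤ ε * M := by gcongr; exact hsM x
      linarith
    have hgap : Q₀ - s₀ * p₀ ≤ Q x - s x * p x + 2 * ε * (1 + 2 * M) := by linarith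
    -- This makes the power of `H` produced by the local bound at most `p x`, so, as `H ≥ 1`, the
    -- modular of `H` controls it.
    have hexp : (1 - s₀ * p₀ / Q₀) * (β x + c / 2) ≤ p x := by
      have e1 : (Q₀ - s₀ * p₀) * (β x + c / 2) ≤ Q₀ * p x := by
        have e2 : (Q₀ - s₀ * p₀) * (β x + c / 2) ≤
            (Q x - s x * p x + 2 * ε * (1 + 2 * M)) * (β x + c / 2) := by gcongr
        have e3 : 2 * ε * (1 + 2 * M) * (β x + c / 2) ≤ 2 * ε * (1 + 2 * M) * (B + c) := by
          gcongr; linarith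
        have e4 : c * (c / 2) ≤ (Q x - s x * p x) * (c / 2) := by
          gcongr; linarith [hsp x]
        have e5 : Q x * p x ≤ Q₀ * p x :=
          mul_le_mul_of_nonneg_right (by linarith) (ha.le.trans (hpa x))
        linarith
      have e6 : 1 - s₀ * p₀ / Q₀ = (Q₀ - s₀ * p₀) / Q₀ := by field_simp
      rw [e6, div_mul_eq_mul_div, div_le_iff₀ hQ₀0]
      linarith
    have hDE : D x₀ ≤ E := (hD' ⟨x₀, hx₀, rfl⟩).trans (le_max_left _ _)
    have hβ' : 0 ≤ β x + c / 2 := by linarith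
    have hD0 := hD1 x₀
    rw [Real.enorm_eq_ofReal_abs, ENNReal.ofReal_rpow_of_nonneg (abs_nonneg _) hβ',
      ← ENNReal.ofReal_mul (by positivity)]
    refine ENNReal.ofReal_le_ofReal ?_
    calc |f x| ^ (β x + c / 2) ≤ (E * H x ^ (1 - s₀ * p₀ / Q₀)) ^ (β x + c / 2) := by
          refine Real.rpow_le_rpow (abs_nonneg _) (hfx.trans ?_) hβ'
          gcongr
      _ = E ^ (β x + c / 2) * H x ^ ((1 - s₀ * p₀ / Q₀) * (β x + c / 2)) := by
          rw [Real.mul_rpow (by linarith) (by positivity), ← Real.rpow_mul (by linarith)]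
      _ ≤ E ^ (B + c) * H x ^ p x := by
          exact mul_le_mul (Real.rpow_le_rpow_of_exponent_le hE1 (by linarith))
            (Real.rpow_le_rpow_of_exponent_le hHx hexp) (by positivity) (by positivity)
  calc ∫⁻ x, ‖f x‖ₑ ^ (β x + c / 2) ∂μ
      ≤ ∫⁻ x, ENNReal.ofReal (E ^ (B + c)) * ENNReal.ofReal (H x ^ p x) ∂μ := lintegral_mono_ae hpt
    _ = ENNReal.ofReal (E ^ (B + c)) * ∫⁻ x, ENNReal.ofReal (H x ^ p x) ∂μ :=
        lintegral_const_mul _ (h.measurable.pow hp).ennreal_ofReal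
    _ ≤ _ := by gcongr; exact h.modular_le

/-! ### Modulars and Luxemburg norms. -/

theorem phiExp_of_ne_top {p : ℝ≥0∞} (hp : p ≠ ∞) (t : ℝ≥0∞) : phiExp p t = t ^ p.toReal :=
  if_neg hp

theorem phiExp_mono (p : ℝ≥0∞) : Monotone (phiExp p) := by
  intro t t' h
  unfold phiExp
  split_ifs with h1 h2 h3 h3
  · exact le_rfl
  · exact bot_le
  · exact absurd (h.trans h3) h2
  · exact le_rfl
  · exact ENNReal.rpow_le_rpow h ENNReal.toReal_nonneg

section Modular

variable {X : Type*} [MeasurableSpace X] {μ : Measure X} {p : X → ℝ≥0∞} {f g : X → ℝ≥0∞}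

theorem varModular_mono_ae (h : f ≤ᵐ[μ] g) : varModular μ p f ≤ varModular μ p g :=
  lintegral_mono_ae (h.mono fun x hx => phiExp_mono (p x) hx)

theorem varModular_eq_lintegral_rpow (hp : ∀ᵐ x ∂μ, p x ≠ ∞) :
    varModular μ p f = ∫⁻ x, f x ^ (p x).toReal ∂μ :=
  lintegral_congr_ae (hp.mono fun _ hx => phiExp_of_ne_top hx _)

theorem luxNorm_le {c : ℝ≥0∞} (hc : 0 < c) (hc' : c < ∞)
    (h : varModular μ p (fun x => f x / c) ≤ 1) : luxNorm μ p f ≤ c :=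
  sInf_le ⟨hc, hc', h⟩

theorem varModular_div_le_one {c : ℝ≥0∞} (h : luxNorm μ p f < c) :
    varModular μ p (fun x => f x / c) ≤ 1 := by
  obtain ⟨c', ⟨-, -, h1⟩, hlt⟩ := sInf_lt_iff.mp h
  exact (varModular_mono_ae (Eventually.of_forall fun x =>
    ENNReal.div_le_div_left hlt.le _)).trans h1

theorem lintegral_rpow_le_add [IsFiniteMeasure μ] {b : X → ℝ} {δ : ℝ} (hδ : 0 ≤ δ)
    (hb : ∀ᵐ x ∂μ, 0 ≤ b x) :
    ∫⁻ x, f x ^ b x ∂μ ≤ μ Set.univ + ∫⁻ x, f x ^ (b x + δ) ∂μ := by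
  calc ∫⁻ x, f x ^ b x ∂μ ≤ ∫⁻ x, (1 + f x ^ (b x + δ)) ∂μ := by
        refine lintegral_mono_ae (hb.mono fun x hx => ?_)
        rcases le_total (f x) 1 with h | h
        · exact (ENNReal.rpow_le_one h hx).trans le_self_add
        · exact (ENNReal.rpow_le_rpow_of_exponent_le h (by linarith)).trans le_add_self
    _ = _ := by rw [lintegral_add_left measurable_const, lintegral_one]

end Modular

/-- Turns modular bounds into norm bounds: since `p ≥ a > 0` a.e., dividing `f` by `E ≥ 1` shrinks
the modular by at least `E^(-a)`, and `E` depends only on the bound `C`. -/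
theorem VarExponent.exists_scale {X : Type*} [MeasurableSpace X] {μ : Measure X} {p : X → ℝ≥0∞}
    (hp : VarExponent μ p) (hfin : ∀ᵐ x ∂μ, p x ≠ ∞) {C : ℝ≥0∞} (hC : C ≠ ∞) :
    ∃ E : ℝ≥0, 1 ≤ E ∧ ∀ f : X → ℝ≥0∞, ∫⁻ x, f x ^ (p x).toReal ∂μ ≤ C →
      varModular μ p (fun x => f x / E) ≤ 1 := by
  obtain ⟨a, ha0, ha⟩ := hp.exists_ae_ge
  obtain ⟨t, ht1, htC⟩ := exists_one_le_lt_rpow_mul hC (p₀ := a) (m := 1) ha0 one_pos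
  have ht0 : 0 < t := by linarith
  refine ⟨t.toNNReal, by simpa using ht1, fun f hf => ?_⟩
  rw [varModular_eq_lintegral_rpow hfin]
  have hT : ENNReal.ofReal t ^ (a : ℝ) = ENNReal.ofReal (t ^ (a : ℝ)) :=
    ENNReal.ofReal_rpow_of_pos ht0
  have hT0 : ENNReal.ofReal (t ^ (a : ℝ)) ≠ 0 := by simp; positivity
  calc ∫⁻ x, (f x / (t.toNNReal : ℝ≥0∞)) ^ (p x).toReal ∂μ
      ≤ ∫⁻ x, (ENNReal.ofReal (t ^ (a : ℝ)))⁻¹ * f x ^ (p x).toReal ∂μ := by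
        refine lintegral_mono_ae ?_
        filter_upwards [ha, hfin] with x hx hx'
        have hax : (a : ℝ) ≤ (p x).toReal :=
          (ENNReal.ofReal_le_iff_le_toReal hx').mp (by simpa using hx)
        rw [ENNReal.div_rpow_of_nonneg _ _ ENNReal.toReal_nonneg, div_eq_mul_inv, mul_comm]
        gcongr
        rw [← hT]
        exact ENNReal.rpow_le_rpow_of_exponent_le (by simpa using ht1) hax
    _ = (ENNReal.ofReal (t ^ (a : ℝ)))⁻¹ * ∫⁻ x, f x ^ (p x).toReal ∂μ :=
        lintegral_const_mul' _ _ (by simpa using hT0)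
    _ ≤ (ENNReal.ofReal (t ^ (a : ℝ)))⁻¹ * ENNReal.ofReal (t ^ (a : ℝ)) := by
        gcongr
        rw [mul_one] at htC
        exact hf.trans htC.le
    _ = 1 := ENNReal.inv_mul_cancel hT0 ENNReal.ofReal_ne_top

theorem luxNorm_lt_top_of_mem_varLebesgue {X : Type*} [MeasurableSpace X] {μ : Measure X}
    {p : X → ℝ≥0∞} (hp : VarExponent μ p) (hfin : ∀ᵐ x ∂μ, p x ≠ ∞) {u : X →ₘ[μ] ℝ}
    (hu : u ∈ varLebesgue μ p) : varLebesgueNorm μ p u < ∞ := by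
  obtain ⟨c, hc0, hc, hm⟩ := hu
  obtain ⟨E, hE1, hE⟩ := hp.exists_scale hfin hm.ne
  have h1 := hE _ (varModular_eq_lintegral_rpow (f := fun x => c * ‖u x‖ₑ) hfin).ge
  have hE0 : (E : ℝ≥0∞) ≠ 0 := by simpa using (zero_lt_one.trans_le hE1).ne'
  refine (luxNorm_le (c := E / c) (ENNReal.div_pos hE0 hc.ne)
    (ENNReal.div_lt_top (by simp) hc0.ne') ?_).trans_lt
    (ENNReal.div_lt_top (by simp) hc0.ne')
  refine le_of_eq_of_le (congrArg _ (funext fun x => ?_)) h1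
  rw [div_eq_mul_inv, ENNReal.inv_div (Or.inl hc.ne) (Or.inl hc0.ne'), div_eq_mul_inv,
    div_eq_mul_inv]
  ring

/-! ### The compact embedding criterion. -/

theorem isOpenPosMeasure_of_ball_pos {X : Type*} [MetricSpace X] [MeasurableSpace X]
    {μ : Measure X} (h : ∀ (x : X) (r : ℝ), 0 < r → 0 < μ (Metric.ball x r)) :
    μ.IsOpenPosMeasure := by
  refine ⟨fun U hU ⟨x, hx⟩ => ?_⟩
  obtain ⟨r, hr, hrU⟩ := Metric.isOpen_iff.mp hU x hx
  exact ((h x r hr).trans_le (measure_mono hrU)).ne'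

theorem isFiniteMeasure_of_totallyBounded {X : Type*} [MetricSpace X] [MeasurableSpace X]
    {μ : Measure X} (htb : TotallyBounded (Set.univ : Set X))
    (h : ∀ (x : X) (r : ℝ), 0 < r → μ (Metric.ball x r) < ∞) : IsFiniteMeasure μ := by
  obtain ⟨t, ht, hcov⟩ := Metric.totallyBounded_iff.mp htb 1 one_pos
  refine ⟨(measure_mono hcov).trans_lt ?_⟩
  exact (measure_biUnion_lt_top ht fun x _ => h x 1 one_pos)

/-- The subcritical condition in polynomial form. -/
theorem StrictlyBelow.exists_ae_mul_le {X : Type*} [MeasurableSpace X] {μ : Measure X}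
    {Q s p β : X → ℝ≥0∞} (hQ : ∀ x, Q x ≠ ∞) (hp : ∀ x, p x ≠ ∞) 
    (hβ : ∀ᵐ x ∂μ, β x ≠ ∞) (hsp : ∀ᵐ x ∂μ, s x * p x < Q x)
    (h : StrictlyBelow μ β (sobolevExponent Q s p)) :
    ∃ c : ℝ, 0 < c ∧ ∀ᵐ x ∂μ, ((β x).toReal + c) * ((Q x).toReal - (s x).toReal * (p x).toReal) ≤
      (Q x).toReal * (p x).toReal := by
  obtain ⟨c, hc0, hc⟩ := h.exists_ae_add_le
  refine ⟨c, hc0, ?_⟩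
  filter_upwards [hc, hβ, hsp] with x hx hβx hspx
  -- The strict inequality `s p < Q` makes the truncated difference a genuine one and the
  -- denominator nonzero.
  have h1 : Q x - s x * p x ≠ 0 := (tsub_pos_of_lt hspx).ne'
  have h2 : Q x - s x * p x ≠ ∞ := ne_top_of_le_ne_top (hQ x) tsub_le_self
  have h3 := (ENNReal.le_div_iff_mul_le (Or.inl h1) (Or.inl h2)).mp hx
  have h4 := ENNReal.toReal_mono (ENNReal.mul_ne_top (hQ x) (hp x)) h3
  rwa [ENNReal.toReal_mul, ENNReal.toReal_mul, ENNReal.toReal_sub_of_le hspx.le (hQ x),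
    ENNReal.toReal_add hβx ENNReal.coe_ne_top, ENNReal.toReal_mul, ENNReal.coe_toReal] at h4

/-- A uniform subcritical modular estimate for scalar Hajłasz pairs, for extended exponents. -/
theorem HajlaszPair.exists_modular_le {X : Type*} [MetricSpace X] [MeasurableSpace X]
    {μ : Measure X} [μ.IsOpenPosMeasure] (htb : TotallyBounded (Set.univ : Set X))
    {Q p s β : X → ℝ≥0∞} (hQ : BddLogExponent μ Q) (hreg : LowerAhlforsRegular μ Q)
    (hp : BddLogExponent μ p) (hs : BddLogExponent μ s)
    (hsp : StrictlyBelow μ (fun x => s x * p x) Q) (hβ : BddVarExponent μ β)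
    (hβγ : StrictlyBelow μ β (sobolevExponent Q s p)) {K : ℝ≥0∞} (hK : K ≠ ∞) :
    ∃ (δ : ℝ) (C : ℝ≥0∞), 0 < δ ∧ C ≠ ∞ ∧ ∀ f H : X → ℝ,
      HajlaszPair μ (fun x => (s x).toReal) (fun x => (p x).toReal) K f H →
        ∫⁻ x, ‖f x‖ₑ ^ ((β x).toReal + δ) ∂μ ≤ C := by
  obtain ⟨a₁, b₁, ha₁, hQb, hQc⟩ := hQ.exists_bounds
  obtain ⟨a₂, b₂, ha₂, hpb, hpc⟩ := hp.exists_bounds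
  obtain ⟨a₃, b₃, ha₃, hsb, hsc⟩ := hs.exists_bounds
  obtain ⟨B, -, hβB⟩ := hβ.exists_ae_le
  have hβtop : ∀ᵐ x ∂μ, β x ≠ ∞ := hβB.mono fun x hx => ne_top_of_le_ne_top ENNReal.coe_ne_top hx
  obtain ⟨c₁, hc₁, hspc⟩ := hsp.exists_ae_add_le
  have hsplt : ∀ᵐ x ∂μ, s x * p x < Q x := hspc.mono fun x hx =>
    (ENNReal.lt_add_right (ENNReal.mul_ne_top (hsb x).1 (hpb x).1)
      (by simpa using hc₁.ne')).trans_le hx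
  obtain ⟨c₂, hc₂, hβc⟩ :=
    hβγ.exists_ae_mul_le (fun x => (hQb x).1) (fun x => (hpb x).1) hβtop hsplt
  obtain ⟨b, hb, hreg⟩ := hreg
  have hspr : ∀ᵐ x ∂μ, (s x).toReal * (p x).toReal + c₁ ≤ (Q x).toReal := by
    filter_upwards [hspc] with x hx
    have := ENNReal.toReal_mono (hQb x).1 hx
    rwa [ENNReal.toReal_add (ENNReal.mul_ne_top (hsb x).1 (hpb x).1) ENNReal.coe_ne_top,
      ENNReal.toReal_mul, ENNReal.coe_toReal] at this
  -- The a.e. inequality is closed in `x` by continuity, and a set of full measure is dense.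
  have hspall : ∀ x, (s x).toReal * (p x).toReal + c₁ ≤ (Q x).toReal := by
    have hcl : IsClosed {x | (s x).toReal * (p x).toReal + c₁ ≤ (Q x).toReal} :=
      isClosed_le ((hsc.continuous.mul hpc.continuous).add continuous_const) hQc.continuous
    intro x
    have h1 := (Measure.dense_of_ae hspr).closure_eq
    rw [hcl.closure_eq] at h1
    exact (h1 ▸ Set.mem_univ x : x ∈ {x | (s x).toReal * (p x).toReal + c₁ ≤ (Q x).toReal})
  set c := min (c₁ : ℝ) c₂ with hc
  have hc0 : 0 < c := lt_min hc₁ hc₂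
  obtain ⟨C, hC, h⟩ := HajlaszPair.exists_lintegral_le (μ := μ) htb (a := min a₁ (min a₂ a₃))
    (M := max b₂ b₃) (B := B) (b := b) (c := c) (β := fun x => (β x).toReal)
    (lt_min ha₁ (lt_min ha₂ ha₃)) hb hc0 hp.measurable.ennreal_toReal hpc hsc hQc
    (fun x => ((min_le_right _ _).trans (min_le_left _ _)).trans (hpb x).2.1)
    (fun x => (hpb x).2.2.trans (le_max_left _ _))
    (fun x => ((min_le_right _ _).trans (min_le_right _ _)).trans (hsb x).2.1)
    (fun x => (hsb x).2.2.trans (le_max_right _ _))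
    (fun x => (min_le_left _ _).trans (hQb x).2.1) hreg
    (fun x => by linarith [hspall x, min_le_left (c₁ : ℝ) c₂]) (by
      filter_upwards [hβB, hβc] with x h1 h2
      refine ⟨ENNReal.toReal_nonneg, ENNReal.toReal_le_of_le_ofReal B.2 (by simpa using h1), ?_⟩
      have h3 : 0 ≤ (Q x).toReal - (s x).toReal * (p x).toReal := by
        have := hspall x; have : (0 : ℝ) < c₁ := hc₁; linarith
      refine le_trans ?_ h2
      gcongr
      exact min_le_right _ _) hK
  exact ⟨c / 2, C, by positivity, hC, h⟩

/-- If every `u ∈ A` yields, after normalization, a scalar Hajłasz pair with a fixed modular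
bound, then `A` embeds compactly into `L^{β(·)}` for all subcritical `β`. -/
theorem compactEmbedding_of_hajlaszPair {X : Type*} [MetricSpace X] [MeasurableSpace X]
    {μ : Measure X}
    (hball : ∀ (x : X) (r : ℝ), 0 < r → 0 < μ (Metric.ball x r) ∧ μ (Metric.ball x r) < ∞)
    (htb : TotallyBounded (Set.univ : Set X))
    {Q p s β : X → ℝ≥0∞} (hQ : BddLogExponent μ Q) (hreg : LowerAhlforsRegular μ Q)
    (hp : BddLogExponent μ p) (hs : BddLogExponent μ s)
    (hsp : StrictlyBelow μ (fun x => s x * p x) Q) (hβ : BddVarExponent μ β)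
    (hβγ : StrictlyBelow μ β (sobolevExponent Q s p)) {A : Set (X →ₘ[μ] ℝ)}
    {normA : (X →ₘ[μ] ℝ) → ℝ≥0∞} {K : ℝ≥0∞} (hK : K ≠ ∞) (hfin : ∀ u ∈ A, normA u < ∞)
    (hpair : ∀ u ∈ A, ∀ l : ℝ≥0, normA u < l → ∃ H : X → ℝ,
      HajlaszPair μ (fun x => (s x).toReal) (fun x => (p x).toReal) K (fun x => u x / l) H) :
    CompactEmbedding A normA (varLebesgue μ β) (varLebesgueNorm μ β) := by
  have : μ.IsOpenPosMeasure := isOpenPosMeasure_of_ball_pos fun x r hr => (hball x r hr).1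
  have : IsFiniteMeasure μ :=
    isFiniteMeasure_of_totallyBounded htb fun x r hr => (hball x r hr).2
  have : TopologicalSpace.SeparableSpace X :=
    TopologicalSpace.isSeparable_univ_iff.mp htb.isSeparable
  obtain ⟨δ, C, hδ, hC, hmod⟩ :=
    HajlaszPair.exists_modular_le htb hQ hreg hp hs hsp hβ hβγ hK
  obtain ⟨B, -, hβB⟩ := hβ.exists_ae_le
  have hβtop : ∀ᵐ x ∂μ, β x ≠ ∞ := hβB.mono fun x hx => ne_top_of_le_ne_top ENNReal.coe_ne_top hx
  have hβ0 : ∀ᵐ x ∂μ, 0 < (β x).toReal :=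
    hβtop.mono fun x hx => ENNReal.toReal_pos (hβ.ne_zero x) hx
  have hβB' : ∀ᵐ x ∂μ, (β x).toReal ≤ B := hβB.mono fun x hx =>
    ENNReal.toReal_le_of_le_ofReal B.2 (by simpa using hx)
  have hβm : Measurable fun x => (β x).toReal := hβ.measurable.ennreal_toReal
  have hC' : μ Set.univ + C ≠ ∞ := ENNReal.add_ne_top.mpr ⟨measure_ne_top μ _, hC⟩
  obtain ⟨E, hE1, hE⟩ := hβ.exists_scale hβtop hC'
  have hE0 : (E : ℝ≥0∞) ≠ 0 := by simpa using (zero_lt_one.trans_le hE1).ne'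
  have hdiv : ∀ (l : ℝ≥0) (t : ℝ), l ≠ 0 → ‖t / (l : ℝ)‖ₑ = ‖t‖ₑ / l := by
    intro l t hl
    rw [div_eq_mul_inv, enorm_mul, enorm_inv (by simpa using hl), div_eq_mul_inv]
    simp [Real.enorm_eq_ofReal_abs]
  have hpos : ∀ (u : X →ₘ[μ] ℝ) (l : ℝ≥0), normA u < l → l ≠ 0 := fun u l h =>
    fun h0 => by simp [h0] at h
  have hmodA : ∀ u ∈ A, ∀ l : ℝ≥0, normA u < l →
      ∫⁻ x, (‖u x‖ₑ / l) ^ (β x).toReal ∂μ ≤ μ Set.univ + C := by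
    intro u hu l hl
    obtain ⟨H, hH⟩ := hpair u hu l hl
    refine (lintegral_rpow_le_add hδ.le (hβ0.mono fun _ h => h.le)).trans ?_
    gcongr
    have := hmod _ H hH
    simp only [hdiv l _ (hpos u l hl)] at this
    exact this
  refine ⟨fun u hu => ?_, ⟨E, fun u hu => ?_⟩, fun u hu ⟨C₀, hC₀⟩ => ?_⟩
  · obtain ⟨l, hl, -⟩ := ENNReal.lt_iff_exists_nnreal_btwn.mp (hfin u hu)
    have hl0 := hpos u l hl
    refine ⟨(l : ℝ≥0∞)⁻¹, by simp, by simpa using pos_iff_ne_zero.mpr hl0, ?_⟩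
    rw [varModular_eq_lintegral_rpow hβtop]
    refine lt_of_le_of_lt ?_ hC'.lt_top
    simpa only [mul_comm, div_eq_mul_inv] using hmodA u hu l hl
  -- Passing to every `r > E * normA u` leaves room for a finite normalizer `l` with `normA u < l`,
  -- also when `normA u = 0`.
  · refine le_of_forall_gt_imp_ge_of_dense fun r hr => ?_
    have h1 : normA u < r / E := by
      rw [ENNReal.lt_div_iff_mul_lt (Or.inl hE0) (Or.inl ENNReal.coe_ne_top), mul_comm]
      exact hr
    obtain ⟨l, hl, hlr⟩ := ENNReal.lt_iff_exists_nnreal_btwn.mp h1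
    have hl0 : (l : ℝ≥0∞) ≠ 0 := by simpa using hpos u l hl
    have h2 : varLebesgueNorm μ β u ≤ l * E := by
      refine luxNorm_le (pos_iff_ne_zero.mpr (mul_ne_zero hl0 hE0))
        (ENNReal.mul_lt_top (by simp) (by simp)) ?_
      refine le_of_eq_of_le (congrArg _ (funext fun x => ?_)) (hE _ (hmodA u hu l hl))
      rw [div_eq_mul_inv, div_eq_mul_inv, div_eq_mul_inv,
        ENNReal.mul_inv (Or.inl hl0) (Or.inl (by simp)), mul_assoc]
    refine h2.trans ?_
    rw [ENNReal.lt_div_iff_mul_lt (Or.inl hE0) (Or.inl ENNReal.coe_ne_top)] at hlr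
    exact hlr.le
  -- One normalizer for the whole sequence; the limit in `L^{β(·)}` is `l * v`, where `v` is the
  -- a.e. limit of `u n / l`.
  · set l : ℝ≥0 := C₀ + 1 with hl
    have hl0 : l ≠ 0 := by positivity
    have hll : ∀ n, normA (u n) < l := fun n => (hC₀ n).trans_lt (by
      rw [hl]; exact_mod_cast lt_add_one C₀)
    choose H hH using fun n => hpair (u n) (hu n) l (hll n)
    obtain ⟨a₂, b₂, ha₂, hpb, -⟩ := hp.exists_bounds
    obtain ⟨a₃, b₃, ha₃, hsb, -⟩ := hs.exists_bounds
    have hfm : ∀ n, Measurable fun x => u n x / (l : ℝ) := fun n =>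
      (u n).measurable.div_const _
    obtain ⟨φ, hφ, v, hv, hlim⟩ := HajlaszPair.exists_ae_tendsto_subseq
      hp.measurable.ennreal_toReal ha₂ (fun x => (hpb x).2.1) ha₃ (fun x => (hsb x).2.1) hK hH hfm
    have hlv : AEStronglyMeasurable (fun x => (l : ℝ) * v x) μ :=
      (hv.const_mul _).aestronglyMeasurable
    have hvC := lintegral_rpow_le_of_tendsto (hβm.add_const δ) (fun n => hfm (φ n)) hlim
      (fun n => hmod _ _ (hH (φ n)))
    have hlr : (l : ℝ) ≠ 0 := by simpa using hl0
    have hmk := AEEqFun.coeFn_mk (fun x => (l : ℝ) * v x) hlv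
    refine ⟨AEEqFun.mk _ hlv, ⟨(l : ℝ≥0∞)⁻¹, by simp, by simpa using pos_iff_ne_zero.mpr hl0, ?_⟩, φ, hφ, ?_⟩
    · rw [varModular_eq_lintegral_rpow hβtop]
      refine lt_of_le_of_lt ?_ hC'.lt_top
      refine le_trans (le_of_eq (lintegral_congr_ae ?_))
        ((lintegral_rpow_le_add (f := fun x => ‖v x‖ₑ) hδ.le (hβ0.mono fun _ h => h.le)).trans
          (add_le_add le_rfl hvC))
      filter_upwards [hmk] with x hx
      rw [hx, mul_comm, ← div_eq_mul_inv, ← hdiv l _ hl0, mul_div_cancel_left₀ _ hlr]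
    · rw [ENNReal.tendsto_nhds_zero]
      intro ε hε
      obtain ⟨η, hη0, hηε⟩ := ENNReal.lt_iff_exists_nnreal_btwn.mp hε
      have hη0' : η ≠ 0 := by
        rintro rfl; simp at hη0
      have ha : ((max 1 (l / η) : ℝ≥0) : ℝ≥0∞) ≠ ∞ := ENNReal.coe_ne_top
      -- The scale is `l / η`, since `(u - l v) / η = (l / η)(u / l - v)`; the maximum with `1`
      -- meets the requirement `1 ≤ a`.
      filter_upwards [eventually_lintegral_sub_rpow_le_one hβm hδ hβ0 hβB' (fun n => hfm (φ n)) hv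
        hlim hC (fun n => hmod _ _ (hH (φ n))) (by exact_mod_cast le_max_left 1 (l / η)) ha]
        with n hn
      refine (luxNorm_le hη0 ENNReal.coe_lt_top ?_).trans hηε.le
      rw [varModular_eq_lintegral_rpow hβtop]
      refine le_trans (lintegral_mono_ae ?_) hn
      filter_upwards [hmk, AEEqFun.coeFn_sub (u (φ n)) (AEEqFun.mk _ hlv)] with x hx hx'
      refine ENNReal.rpow_le_rpow ?_ ENNReal.toReal_nonneg
      rw [hx', Pi.sub_apply, hx]
      have h1 : u (φ n) x - l * v x = l * (u (φ n) x / l - v x) := by field_simp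
      have h2 : ‖(l : ℝ)‖ₑ = (l : ℝ≥0∞) := by simp [Real.enorm_eq_ofReal_abs]
      rw [h1, enorm_mul, h2, mul_comm, mul_div_assoc, mul_comm, ← ENNReal.coe_div hη0']
      gcongr
      exact le_max_right _ _

/-! ### From vector gradients to scalar pairs. -/

/-- The part of the vector gradient condition that concerns distances less than `1`. -/
theorem IsVectorGradient.exists_nat_scale {X : Type*} [MetricSpace X] [MeasurableSpace X]
    {μ : Measure X} {s : X → ℝ≥0∞} {u : X →ₘ[μ] ℝ} {g : ℤ → X → ℝ≥0∞}
    (h : IsVectorGradient s u g) :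
    ∃ N : Set X, μ N = 0 ∧ ∀ x y, x ∉ N → y ∉ N → x ≠ y → dist x y < 1 →
      ∃ n : ℕ, dist x y ≤ (1 / 2 : ℝ) ^ n ∧
        ‖u x - u y‖ₑ ≤ edist x y ^ (s x).toReal * g n x + edist x y ^ (s y).toReal * g n y := by
  obtain ⟨-, N, hN, hg⟩ := h
  refine ⟨N, hN, fun x y hx hy hne hd => ?_⟩
  obtain ⟨m, hm1, hm2⟩ := exists_mem_Ico_zpow (dist_pos.mpr hne) (one_lt_two (α := ℝ))
  have hm0 : m < 0 := by
    by_contra hcon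
    exact absurd (hm1.trans_lt hd) (not_lt.mpr (one_le_zpow₀ one_le_two (not_lt.mp hcon)))
  -- From `2^m ≤ d < 2^(m+1)` with `m = -n - 1`, the gradient component in force is `g n`; `d < 1`
  -- forces `n ≥ 0`.
  obtain ⟨n, hn⟩ := Int.eq_ofNat_of_zero_le (show 0 ≤ -m - 1 by omega)
  have hm : m = -(n : ℤ) - 1 := by omega
  rw [hm] at hm1 hm2
  rw [sub_add_cancel] at hm2
  refine ⟨n, ?_, hg n x y hx hy hm1 hm2⟩
  rw [zpow_neg, zpow_natCast] at hm2
  rw [one_div, inv_pow]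
  exact hm2.le

/-- A scalar gradient in `L^{p(·)}` gives a scalar Hajłasz pair. -/
theorem exists_hajlaszPair_of_gradient {X : Type*} [MetricSpace X] [MeasurableSpace X]
    {μ : Measure X} {s p : X → ℝ≥0∞} (hp : Measurable p) (hp0 : ∀ x, p x ≠ 0)
    (hpt : ∀ x, p x ≠ ∞) {u : X →ₘ[μ] ℝ} {l : ℝ≥0} (hl : l ≠ 0)
    (hu : varLebesgueNorm μ p u < l) {G : X → ℝ≥0∞} (hG : Measurable G) {K : ℝ≥0∞} (hK : K ≠ ∞)
    (hGK : ∫⁻ x, G x ^ (p x).toReal ∂μ ≤ K)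
    (hgrad : ∃ N : Set X, μ N = 0 ∧ ∀ x y, x ∉ N → y ∉ N → x ≠ y → dist x y < 1 →
      ‖u x - u y‖ₑ / l ≤ edist x y ^ (s x).toReal * G x + edist x y ^ (s y).toReal * G y) :
    ∃ H : X → ℝ, HajlaszPair μ (fun x => (s x).toReal) (fun x => (p x).toReal)
      (μ Set.univ + (1 + K)) (fun x => u x / l) H := by
  have hpr : ∀ x, 0 < (p x).toReal := fun x => ENNReal.toReal_pos (hp0 x) (hpt x)
  have hl0 : (l : ℝ) ≠ 0 := by simpa using hl
  have hnorm : ∀ t : ℝ, ‖t / (l : ℝ)‖ₑ = ‖t‖ₑ / l := fun t => by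
    rw [div_eq_mul_inv, enorm_mul, enorm_inv hl0, div_eq_mul_inv]
    simp [Real.enorm_eq_ofReal_abs]
  obtain ⟨N, hN, hgrad⟩ := hgrad
  have hGm : Measurable fun x => G x ^ (p x).toReal := hG.pow hp.ennreal_toReal
  have hfin : ∀ᵐ x ∂μ, G x ≠ ∞ := by
    filter_upwards [ae_lt_top hGm (ne_top_of_le_ne_top hK hGK)] with x hx htop
    rw [htop, ENNReal.top_rpow_of_pos (hpr x)] at hx
    exact lt_irrefl _ hx
  have hfin' : μ {x | ¬ G x ≠ ∞} = 0 := ae_iff.mp hfin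
  have hum : Measurable fun x => u x / (l : ℝ) := u.measurable.div_const _
  -- Points with `G = ∞` join the null set, as there `toReal` would return `0` and spoil the
  -- gradient inequality. The three entries of the maximum contribute the summands `μ(X)`, `1` and
  -- `K`.
  refine ⟨fun x => max 1 (max |u x / l| (G x).toReal),
    measurable_const.max ((continuous_abs.measurable.comp hum).max hG.ennreal_toReal),
    fun x => le_max_left _ _, ⟨N ∪ {x | ¬ G x ≠ ∞}, ?_, ?_, ?_⟩, ?_⟩
  · exact measure_union_null hN hfin'
  · exact fun x _ => (le_max_left _ _).trans (le_max_right _ _)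
  · intro x y hx hy hd
    rcases eq_or_ne x y with rfl | hne
    · simp only [sub_self, abs_zero]; positivity
    rw [Set.mem_union, not_or] at hx hy
    have hGx : G x ≠ ∞ := not_not.mp hx.2
    have hGy : G y ≠ ∞ := not_not.mp hy.2
    have h1 := hgrad x y hx.1 hy.1 hne hd
    rw [← hnorm, sub_div, Real.enorm_eq_ofReal_abs, edist_dist,
      ENNReal.ofReal_rpow_of_nonneg dist_nonneg ENNReal.toReal_nonneg,
      ENNReal.ofReal_rpow_of_nonneg dist_nonneg ENNReal.toReal_nonneg,
      ← ENNReal.ofReal_toReal hGx, ← ENNReal.ofReal_toReal hGy,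
      ← ENNReal.ofReal_mul (by positivity), ← ENNReal.ofReal_mul (by positivity),
      ← ENNReal.ofReal_add (by positivity) (by positivity),
      ENNReal.ofReal_le_ofReal_iff (by positivity)] at h1
    refine h1.trans ?_
    gcongr
    · exact (le_max_right _ _).trans (le_max_right _ _)
    · exact (le_max_right _ _).trans (le_max_right _ _)
  · have hu1 := varModular_div_le_one hu
    rw [varModular_eq_lintegral_rpow (Eventually.of_forall hpt)] at hu1
    have hm : Measurable fun x => (‖u x‖ₑ / (l : ℝ≥0∞)) ^ (p x).toReal :=
      (u.measurable.enorm.div_const _).pow hp.ennreal_toReal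
    calc ∫⁻ x, ENNReal.ofReal (max 1 (max |u x / l| (G x).toReal) ^ (p x).toReal) ∂μ
        ≤ ∫⁻ x, (1 + ((‖u x‖ₑ / l) ^ (p x).toReal + G x ^ (p x).toReal)) ∂μ := by
          refine lintegral_mono fun x => ?_
          rw [← ENNReal.ofReal_rpow_of_nonneg (by positivity) (hpr x).le]
          rcases max_choice 1 (max |u x / l| (G x).toReal) with h | h <;> rw [h]
          · rw [ENNReal.ofReal_one, ENNReal.one_rpow]; exact le_self_add
          rcases max_choice |u x / l| (G x).toReal with h' | h' <;> rw [h']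
          · rw [← Real.enorm_eq_ofReal_abs, hnorm]
            exact le_add_left le_self_add
          · refine le_add_left (le_add_left ?_)
            exact ENNReal.rpow_le_rpow ENNReal.ofReal_toReal_le (hpr x).le
      _ = μ Set.univ + (∫⁻ x, (‖u x‖ₑ / l) ^ (p x).toReal ∂μ
            + ∫⁻ x, G x ^ (p x).toReal ∂μ) := by
          rw [lintegral_add_left measurable_const, lintegral_one, lintegral_add_left hm]
      _ ≤ _ := by gcongr

theorem le_rpow_tsum_rpow {ι : Type*} (a : ι → ℝ≥0∞) {r : ℝ} (hr : 0 < r) (k : ι) :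
    a k ≤ (∑' i, a i ^ r) ^ (1 / r) := by
  calc a k = (a k ^ r) ^ (1 / r) := by
        rw [← ENNReal.rpow_mul, mul_one_div_cancel hr.ne', ENNReal.rpow_one]
    _ ≤ _ := by
        gcongr
        exact ENNReal.le_tsum k

theorem le_seqNorm {q : ℝ≥0∞} (hq : q ≠ 0) (a : ℤ → ℝ≥0∞) (k : ℤ) : a k ≤ seqNorm q a := by
  unfold seqNorm
  split_ifs with h
  · exact le_iSup a k
  · exact le_rpow_tsum_rpow a (ENNReal.toReal_pos hq h) k

/-- Functions in the Hajłasz–Triebel–Lizorkin space have scalar gradients in `L^{p(·)}`. -/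
theorem exists_hajlaszPair_of_hajlaszTLNorm_lt {X : Type*} [MetricSpace X] [MeasurableSpace X]
    {μ : Measure X} {s p q : X → ℝ≥0∞} (hp : Measurable p) (hp0 : ∀ x, p x ≠ 0)
    (hpt : ∀ x, p x ≠ ∞) (hq : ∀ x, q x ≠ 0) {u : X →ₘ[μ] ℝ} {l : ℝ≥0}
    (hu : hajlaszTLNorm μ s p q u < l) :
    ∃ H : X → ℝ, HajlaszPair μ (fun x => (s x).toReal) (fun x => (p x).toReal)
      (μ Set.univ + (1 + 1)) (fun x => u x / l) H := by
  have hl : l ≠ 0 := by rintro rfl; simp at hu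
  obtain ⟨⟨g, hg⟩, hgl⟩ := iInf_lt_iff.mp (lt_of_le_of_lt le_add_self hu : homTLNorm μ s p q u < l)
  obtain ⟨N, hN, hgN⟩ := hg.exists_nat_scale
  have h1 := varModular_div_le_one hgl
  rw [varModular_eq_lintegral_rpow (Eventually.of_forall hpt)] at h1
  refine exists_hajlaszPair_of_gradient hp hp0 hpt hl (le_self_add.trans_lt hu)
    (G := fun x => (⨆ k, g k x) / l) ((Measurable.iSup hg.1).div_const _) ENNReal.one_ne_top
    (le_trans (lintegral_mono fun x => ?_) h1) ⟨N, hN, fun x y hx hy hne hd => ?_⟩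
  · refine ENNReal.rpow_le_rpow (ENNReal.div_le_div_right ?_ _) ENNReal.toReal_nonneg
    exact iSup_le fun k => le_seqNorm (hq x) _ k
  · obtain ⟨n, -, hn⟩ := hgN x y hx hy hne hd
    rw [← mul_div_assoc, ← mul_div_assoc, ← ENNReal.add_div]
    gcongr
    refine hn.trans ?_
    gcongr
    · exact le_iSup (fun k : ℤ => g k x) n
    · exact le_iSup (fun k : ℤ => g k y) n

theorem seqLpModular_mono {X : Type*} [MeasurableSpace X] {μ : Measure X} {p q : X → ℝ≥0∞}
    {g g' : ℤ → X → ℝ≥0∞} (h : ∀ k x, g k x ≤ g' k x) :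
    seqLpModular μ p q g ≤ seqLpModular μ p q g' :=
  ENNReal.tsum_le_tsum fun k => sInf_le_sInf fun _ ⟨h0, hT, hc⟩ => ⟨h0, hT,
    (varModular_mono_ae (Eventually.of_forall fun x => ENNReal.div_le_div_right (h k x) _)).trans hc⟩

/-- Modular bounds for the components of a sequence in the unit ball of `ℓ^{q(·)}(L^{p(·)})`. -/
theorem exists_component_bounds_of_seqLpNorm_lt {X : Type*} [MeasurableSpace X] {μ : Measure X}
    {p q : X → ℝ≥0∞} (hpt : ∀ x, p x ≠ ∞) {g : ℤ → X → ℝ≥0∞} {l : ℝ≥0∞}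
    (h : seqLpNorm μ p q g < l) :
    ∃ c : ℤ → ℝ≥0∞, (∀ k, c k ≠ 0) ∧ (∀ k, c k ≤ 2) ∧ ∑' k, c k ≤ 2 ∧ ∀ (k : ℤ) (D : ℝ≥0∞),
      (∀ᵐ x ∂μ, c k ^ (((q x)⁻¹).toReal * (p x).toReal) ≤ D) →
        D ≠ ∞ → ∫⁻ x, (g k x / l) ^ (p x).toReal ∂μ ≤ D := by
  have h1 : seqLpModular μ p q (fun k x => g k x / l) ≤ 1 := by
    obtain ⟨c, ⟨-, -, hc⟩, hcl⟩ := sInf_lt_iff.mp h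
    exact (seqLpModular_mono fun k x => ENNReal.div_le_div_left hcl.le _).trans hc
  -- The infimum for each component need not be attained and may be `0`, so near-optimal positive `c
  -- k` are taken with errors of total sum below `1`. This gives the bound `2` for the sum of the `c
  -- k`.
  obtain ⟨ε, hε0, hε⟩ := ENNReal.exists_pos_sum_of_countable one_ne_zero ℤ
  set a : ℤ → ℝ≥0∞ := fun k => sInf {c : ℝ≥0∞ | 0 < c ∧ c < ∞ ∧
    varModular μ p (fun x => g k x / l / c ^ ((q x)⁻¹).toReal) ≤ 1} with ha
  have hsum : ∑' k, a k ≤ 1 := h1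
  have hatop : ∀ k, a k ≠ ∞ := fun k =>
    ne_top_of_le_ne_top ENNReal.one_ne_top ((ENNReal.le_tsum k).trans hsum)
  have hex : ∀ k, ∃ c : ℝ≥0∞, (0 < c ∧ c < ∞ ∧
      varModular μ p (fun x => g k x / l / c ^ ((q x)⁻¹).toReal) ≤ 1) ∧ c < a k + ε k := fun k =>
    sInf_lt_iff.mp (ENNReal.lt_add_right (hatop k) (by simpa using (hε0 k).ne'))
  choose c hc hcε using hex
  have hc2 : ∑' k, c k ≤ 2 := by
    calc ∑' k, c k ≤ ∑' k, (a k + ε k) := ENNReal.tsum_le_tsum fun k => (hcε k).le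
      _ = ∑' k, a k + ∑' k, (ε k : ℝ≥0∞) := ENNReal.tsum_add
      _ ≤ 1 + 1 := add_le_add hsum hε.le
      _ = 2 := one_add_one_eq_two
  refine ⟨c, fun k => (hc k).1.ne', fun k => (ENNReal.le_tsum k).trans hc2, hc2, ?_⟩
  intro k D hD hDt
  obtain ⟨hck0, hckt, hmod⟩ := hc k
  rw [varModular_eq_lintegral_rpow (Eventually.of_forall hpt)] at hmod
  calc ∫⁻ x, (g k x / l) ^ (p x).toReal ∂μ
      ≤ ∫⁻ x, D * (g k x / l / c k ^ ((q x)⁻¹).toReal) ^ (p x).toReal ∂μ := by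
        refine lintegral_mono_ae (hD.mono fun x hx => ?_)
        have e0 : c k ^ ((q x)⁻¹).toReal ≠ 0 := (ENNReal.rpow_pos hck0 hckt.ne).ne'
        have e1 : c k ^ ((q x)⁻¹).toReal ≠ ∞ :=
          ENNReal.rpow_ne_top_of_nonneg ENNReal.toReal_nonneg hckt.ne
        calc (g k x / l) ^ (p x).toReal
            = (c k ^ ((q x)⁻¹).toReal * (g k x / l / c k ^ ((q x)⁻¹).toReal)) ^ (p x).toReal := by
              rw [ENNReal.mul_div_cancel e0 e1]
          _ = c k ^ (((q x)⁻¹).toReal * (p x).toReal)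
                * (g k x / l / c k ^ ((q x)⁻¹).toReal) ^ (p x).toReal := by
              rw [ENNReal.mul_rpow_of_nonneg _ _ ENNReal.toReal_nonneg, ENNReal.rpow_mul]
          _ ≤ _ := by gcongr
    _ = D * ∫⁻ x, (g k x / l / c k ^ ((q x)⁻¹).toReal) ^ (p x).toReal ∂μ :=
        lintegral_const_mul' _ _ hDt
    _ ≤ D * 1 := by gcongr
    _ = D := mul_one D

/-- A vector gradient with summable component modulars gives a scalar Hajłasz pair. -/
theorem exists_hajlaszPair_of_summable_modular {X : Type*} [MetricSpace X] [MeasurableSpace X]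
    {μ : Measure X} {s p : X → ℝ≥0∞} (hp : Measurable p) (hp0 : ∀ x, p x ≠ 0)
    (hpt : ∀ x, p x ≠ ∞) {u : X →ₘ[μ] ℝ} {l : ℝ≥0} (hl : l ≠ 0)
    (hu : varLebesgueNorm μ p u < l) {F : ℕ → X → ℝ≥0∞} (hF : ∀ n, Measurable (F n)) {K : ℝ≥0∞}
    (hK : K ≠ ∞) (hFK : ∑' n, ∫⁻ x, F n x ^ (p x).toReal ∂μ ≤ K)
    (hgrad : ∃ N : Set X, μ N = 0 ∧ ∀ x y, x ∉ N → y ∉ N → x ≠ y → dist x y < 1 → ∃ n,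
      ‖u x - u y‖ₑ / l ≤ edist x y ^ (s x).toReal * F n x + edist x y ^ (s y).toReal * F n y) :
    ∃ H : X → ℝ, HajlaszPair μ (fun x => (s x).toReal) (fun x => (p x).toReal)
      (μ Set.univ + (1 + K)) (fun x => u x / l) H := by
  have hpr : ∀ x, 0 < (p x).toReal := fun x => ENNReal.toReal_pos (hp0 x) (hpt x)
  have hm : ∀ n, Measurable fun x => F n x ^ (p x).toReal := fun n =>
    (hF n).pow hp.ennreal_toReal
  obtain ⟨N, hN, hgrad⟩ := hgrad
  refine exists_hajlaszPair_of_gradient hp hp0 hpt hl hu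
    -- The pointwise `ℓ^{p(x)}` norm dominates every `F n`, and its modular is exactly the sum of
    -- their modulars.
    (G := fun x => (∑' n, F n x ^ (p x).toReal) ^ (1 / (p x).toReal))
    ((Measurable.tsum hm).pow (measurable_const.div hp.ennreal_toReal)) hK ?_
    ⟨N, hN, fun x y hx hy hne hd => ?_⟩
  · refine le_of_eq_of_le ?_ hFK
    rw [← lintegral_tsum fun n => (hm n).aemeasurable]
    refine lintegral_congr fun x => ?_
    rw [← ENNReal.rpow_mul, one_div_mul_cancel (hpr x).ne', ENNReal.rpow_one]
  · obtain ⟨n, hn⟩ := hgrad x y hx hy hne hd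
    refine hn.trans ?_
    gcongr
    · exact le_rpow_tsum_rpow (fun n => F n x) (hpr x) n
    · exact le_rpow_tsum_rpow (fun n => F n y) (hpr y) n

theorem ENNReal.pow_rpow_comm (x : ℝ≥0∞) (n : ℕ) (a : ℝ) : (x ^ n) ^ a = (x ^ a) ^ n := by
  rw [← ENNReal.rpow_natCast, ← ENNReal.rpow_natCast, ← ENNReal.rpow_mul, ← ENNReal.rpow_mul,
    mul_comm]

theorem inv_toReal_mul_toReal_le {p q : ℝ≥0∞} {a : ℝ≥0} {b : ℝ} (ha : 0 < a) (hq : a ≤ q)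
    (hp : p.toReal ≤ b) : (q⁻¹).toReal * p.toReal ≤ (a : ℝ)⁻¹ * b := by
  have h1 : (q⁻¹).toReal ≤ (a : ℝ)⁻¹ := by
    have h2 : q⁻¹ ≤ (a : ℝ≥0∞)⁻¹ := ENNReal.inv_le_inv.mpr hq
    have h3 := ENNReal.toReal_mono (by simpa using ha.ne') h2
    rwa [ENNReal.toReal_inv (a : ℝ≥0∞), ENNReal.coe_toReal] at h3
  exact mul_le_mul h1 hp ENNReal.toReal_nonneg (by positivity)

section Besov

variable {X : Type*} [MetricSpace X] [MeasurableSpace X] {μ : Measure X} {s p q : X → ℝ≥0∞}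

/-- For `q ≤ p` the exponent `r = p/q` is at least `1`, so `c_k^r ≤ 2^R c_k` with `R` an upper bound
for `r`. Summability of the `c_k` passes to the modulars of the components. -/
theorem exists_hajlaszPair_of_hajlaszBesovNorm_lt_of_le (hp : Measurable p) (hp0 : ∀ x, p x ≠ 0)
    (hpt : ∀ x, p x ≠ ∞) {b : ℝ} (hpb : ∀ x, (p x).toReal ≤ b) (hq : VarExponent μ q)
    (hqp : q ≤ᵐ[μ] p) :
    ∃ K : ℝ≥0∞, K ≠ ∞ ∧ ∀ (u : X →ₘ[μ] ℝ) (l : ℝ≥0), hajlaszBesovNorm μ s p q u < l →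
      ∃ H : X → ℝ, HajlaszPair μ (fun x => (s x).toReal) (fun x => (p x).toReal)
        (μ Set.univ + (1 + K)) (fun x => u x / l) H := by
  obtain ⟨a, ha0, ha⟩ := hq.exists_ae_ge
  set R : ℝ := (a : ℝ)⁻¹ * b with hR
  have h2R : (2 : ℝ≥0∞) ^ R ≠ ∞ := ENNReal.rpow_ne_top_of_ne_zero (by simp) (by simp)
  refine ⟨2 ^ R * 2, ENNReal.mul_ne_top h2R (by simp), fun u l hu => ?_⟩
  have hl : l ≠ 0 := by rintro rfl; simp at hu
  obtain ⟨⟨g, hg⟩, hgl⟩ :=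
    iInf_lt_iff.mp (lt_of_le_of_lt le_add_self hu : homBesovNorm μ s p q u < l)
  obtain ⟨N, hN, hgN⟩ := hg.exists_nat_scale
  obtain ⟨c, hc0, hc2, hcs, hc⟩ := exists_component_bounds_of_seqLpNorm_lt hpt hgl
  have hct : ∀ k, c k ≠ ∞ := fun k => ne_top_of_le_ne_top (by simp) (hc2 k)
  have hcomp : ∀ k, ∫⁻ x, (g k x / l) ^ (p x).toReal ∂μ ≤ 2 ^ R * c k := by
    intro k
    refine hc k _ ?_ (ENNReal.mul_ne_top h2R (hct k))
    filter_upwards [ha, hqp] with x hax hqpx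
    set r := ((q x)⁻¹).toReal * (p x).toReal with hr
    have hr1 : 1 ≤ r := by
      have hqt : q x ≠ ∞ := ne_top_of_le_ne_top (hpt x) hqpx
      have hq0 : 0 < (q x).toReal := ENNReal.toReal_pos (hq.ne_zero x) hqt
      rw [hr, ENNReal.toReal_inv, inv_mul_eq_div, one_le_div hq0]
      exact ENNReal.toReal_mono (hpt x) hqpx
    have hrR : r ≤ R := inv_toReal_mul_toReal_le ha0 hax (hpb x)
    calc c k ^ r = c k ^ ((r - 1) + 1) := by rw [sub_add_cancel]
      _ = c k ^ (r - 1) * c k := by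
          rw [ENNReal.rpow_add _ _ (hc0 k) (hct k), ENNReal.rpow_one]
      _ ≤ 2 ^ (r - 1) * c k := by
          gcongr
          exact hc2 k
      _ ≤ 2 ^ R * c k := by
          gcongr
          · norm_num
          · linarith
  refine exists_hajlaszPair_of_summable_modular hp hp0 hpt hl (le_self_add.trans_lt hu)
    (F := fun n x => g n x / l) (fun n => (hg.1 n).div_const _)
    (ENNReal.mul_ne_top h2R (by simp)) ?_ ⟨N, hN, fun x y hx hy hne hd => ?_⟩
  · calc ∑' n : ℕ, ∫⁻ x, (g n x / l) ^ (p x).toReal ∂μ ≤ ∑' n : ℕ, 2 ^ R * c n :=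
          ENNReal.tsum_le_tsum fun n => hcomp n
      _ = 2 ^ R * ∑' n : ℕ, c n := ENNReal.tsum_mul_left
      _ ≤ 2 ^ R * 2 := by
          gcongr
          exact (ENNReal.tsum_comp_le_tsum_of_injective Nat.cast_injective c).trans hcs
  · obtain ⟨n, -, hn⟩ := hgN x y hx hy hne hd
    refine ⟨n, ?_⟩
    rw [← mul_div_assoc, ← mul_div_assoc, ← ENNReal.add_div]
    gcongr

/-- Without `q ≤ p` the component modulars are only bounded, by `2^R`. Decay comes from the
smoothness gap: if `t + δ ≤ s` and `d ≤ 2^(-n)`, then `d^s ≤ d^t θ^n` with `θ = 2^(-δ)`. The weight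
`θ^n` moves into the gradient and, as `p ≥ a`, gives a geometric series of ratio `θ^a`. -/
theorem exists_hajlaszPair_of_hajlaszBesovNorm_lt_of_lt (hp : Measurable p) (hp0 : ∀ x, p x ≠ 0)
    (hpt : ∀ x, p x ≠ ∞) {a b : ℝ} (ha : 0 < a) (hpa : ∀ x, a ≤ (p x).toReal)
    (hpb : ∀ x, (p x).toReal ≤ b) (hq : VarExponent μ q) {t : X → ℝ≥0∞} (hst : ∀ x, s x ≠ ∞)
    (htt : ∀ x, t x ≠ ∞) (hts : StrictlyBelow μ t s) :
    ∃ K : ℝ≥0∞, K ≠ ∞ ∧ ∀ (u : X →ₘ[μ] ℝ) (l : ℝ≥0), hajlaszBesovNorm μ s p q u < l →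
      ∃ H : X → ℝ, HajlaszPair μ (fun x => (t x).toReal) (fun x => (p x).toReal)
        (μ Set.univ + (1 + K)) (fun x => u x / l) H := by
  obtain ⟨a', ha'0, ha'⟩ := hq.exists_ae_ge
  obtain ⟨δ, hδ0, hδ⟩ := hts.exists_ae_add_le
  set R : ℝ := (a' : ℝ)⁻¹ * b with hR
  have h2R : (2 : ℝ≥0∞) ^ R ≠ ∞ := ENNReal.rpow_ne_top_of_ne_zero (by simp) (by simp)
  have hδ0' : (0 : ℝ) < δ := hδ0
  have hhalf : (1 / 2 : ℝ≥0∞) < 1 := by simp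
  set θ : ℝ≥0∞ := (1 / 2) ^ (δ : ℝ) with hθ
  have hθ1 : θ < 1 := ENNReal.rpow_lt_one hhalf hδ0'
  have hθa : θ ^ a < 1 := ENNReal.rpow_lt_one hθ1 ha
  set K : ℝ≥0∞ := (1 - θ ^ a)⁻¹ * 2 ^ R with hK
  have hKt : K ≠ ∞ := ENNReal.mul_ne_top (ENNReal.inv_ne_top.mpr (tsub_pos_of_lt hθa).ne') h2R
  refine ⟨K, hKt, fun u l hu => ?_⟩
  have hl : l ≠ 0 := by rintro rfl; simp at hu
  obtain ⟨⟨g, hg⟩, hgl⟩ :=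
    iInf_lt_iff.mp (lt_of_le_of_lt le_add_self hu : homBesovNorm μ s p q u < l)
  obtain ⟨N, hN, hgN⟩ := hg.exists_nat_scale
  obtain ⟨c, hc0, hc2, hcs, hc⟩ := exists_component_bounds_of_seqLpNorm_lt hpt hgl
  have hcomp : ∀ k, ∫⁻ x, (g k x / l) ^ (p x).toReal ∂μ ≤ 2 ^ R := by
    intro k
    refine hc k _ ?_ h2R
    filter_upwards [ha'] with x hax
    calc c k ^ (((q x)⁻¹).toReal * (p x).toReal) ≤ 2 ^ (((q x)⁻¹).toReal * (p x).toReal) := by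
          gcongr
          exact hc2 k
      _ ≤ 2 ^ R := ENNReal.rpow_le_rpow_of_exponent_le (by norm_num)
          (inv_toReal_mul_toReal_le ha'0 hax (hpb x))
  refine exists_hajlaszPair_of_summable_modular hp hp0 hpt hl (le_self_add.trans_lt hu)
    (F := fun n x => θ ^ n * (g n x / l))
    (fun n => measurable_const.mul ((hg.1 n).div_const _)) hKt ?_
    ⟨N ∪ {x | ¬ t x + δ ≤ s x}, measure_union_null hN (ae_iff.mp hδ),
      fun x y hx hy hne hd => ?_⟩
  · calc ∑' n : ℕ, ∫⁻ x, (θ ^ n * (g n x / l)) ^ (p x).toReal ∂μ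
        ≤ ∑' n : ℕ, (θ ^ a) ^ n * 2 ^ R := by
          refine ENNReal.tsum_le_tsum fun n => ?_
          have hθn : θ ^ n ≤ 1 := pow_le_one₀ bot_le hθ1.le
          have hθna : (θ ^ n) ^ a = (θ ^ a) ^ n := ENNReal.pow_rpow_comm _ _ _
          calc ∫⁻ x, (θ ^ n * (g n x / l)) ^ (p x).toReal ∂μ
              ≤ ∫⁻ x, (θ ^ a) ^ n * (g n x / l) ^ (p x).toReal ∂μ := by
                refine lintegral_mono fun x => ?_
                rw [ENNReal.mul_rpow_of_nonneg _ _ ENNReal.toReal_nonneg, ← hθna]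
                gcongr ?_ * _
                exact ENNReal.rpow_le_rpow_of_exponent_ge hθn (hpa x)
            _ = (θ ^ a) ^ n * ∫⁻ x, (g n x / l) ^ (p x).toReal ∂μ :=
                lintegral_const_mul' _ _ (ENNReal.pow_ne_top hθa.ne_top)
            _ ≤ _ := by gcongr; exact hcomp n
      _ = K := by rw [ENNReal.tsum_mul_right, ENNReal.tsum_geometric]
  · rw [Set.mem_union, not_or] at hx hy
    obtain ⟨n, hnd, hn⟩ := hgN x y hx.1 hy.1 hne hd
    refine ⟨n, ?_⟩
    have hed : edist x y ≤ (1 / 2) ^ n := by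
      rw [edist_dist]
      refine (ENNReal.ofReal_le_ofReal hnd).trans (le_of_eq ?_)
      rw [ENNReal.ofReal_pow (by norm_num), ENNReal.ofReal_div_of_pos two_pos]
      simp
    have hed1 : edist x y ≤ 1 := hed.trans (pow_le_one₀ bot_le hhalf.le)
    have hpow : ∀ z, t z + δ ≤ s z → edist x y ^ (s z).toReal ≤ edist x y ^ (t z).toReal * θ ^ n := by
      intro z hz
      have hz' : (t z).toReal + δ ≤ (s z).toReal := by
        have := ENNReal.toReal_mono (hst z) hz
        rwa [ENNReal.toReal_add (htt z) ENNReal.coe_ne_top, ENNReal.coe_toReal] at this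
      calc edist x y ^ (s z).toReal ≤ edist x y ^ ((t z).toReal + δ) :=
            ENNReal.rpow_le_rpow_of_exponent_ge hed1 hz'
        _ = edist x y ^ (t z).toReal * edist x y ^ (δ : ℝ) :=
            ENNReal.rpow_add_of_nonneg _ _ ENNReal.toReal_nonneg hδ0'.le
        _ ≤ edist x y ^ (t z).toReal * ((1 / 2) ^ n) ^ (δ : ℝ) := by gcongr
        _ = edist x y ^ (t z).toReal * θ ^ n := by
            rw [ENNReal.pow_rpow_comm]
    rw [← mul_assoc, ← mul_assoc, ← mul_div_assoc, ← mul_div_assoc, ← ENNReal.add_div]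
    gcongr
    refine hn.trans ?_
    gcongr
    · exact hpow x (not_not.mp hx.2)
    · exact hpow y (not_not.mp hy.2)

end Besov

/-! ### Proof of the theorem. -/

theorem StrictlyBelow.mul_right_of_strictlyBelow {X : Type*} [MeasurableSpace X] {μ : Measure X}
    {Q p s t : X → ℝ≥0∞} (hts : StrictlyBelow μ t s)
    (h : StrictlyBelow μ (fun x => s x * p x) Q) : StrictlyBelow μ (fun x => t x * p x) Q := by
  obtain ⟨c, hc0, hc⟩ := hts.exists_ae_add_le
  refine lt_of_lt_of_le h (essInf_mono_ae ?_)
  filter_upwards [hc] with x hx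
  exact tsub_le_tsub_left (mul_le_mul_left (le_self_add.trans hx) _) _

theorem mainTheorem9 {X : Type*} [MetricSpace X] [MeasurableSpace X] [BorelSpace X]
    (μ : Measure X)
    (hball : ∀ (x : X) (r : ℝ), 0 < r → 0 < μ (Metric.ball x r) ∧ μ (Metric.ball x r) < ∞)
    (htb : TotallyBounded (Set.univ : Set X))
    (Q p s q : X → ℝ≥0∞)
    (hQ : BddLogExponent μ Q) (hreg : LowerAhlforsRegular μ Q)
    (hq : VarExponent μ q) (hp : BddLogExponent μ p) (hs : BddLogExponent μ s)
    (hsp : StrictlyBelow μ (fun x => s x * p x) Q) :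
    (∀ β : X → ℝ≥0∞, BddVarExponent μ β →
      p ≤ᵐ[μ] β → StrictlyBelow μ β (sobolevExponent Q s p) →
      CompactEmbedding (hajlaszTL μ s p q) (hajlaszTLNorm μ s p q)
        (varLebesgue μ β) (varLebesgueNorm μ β)) ∧
    (q ≤ᵐ[μ] p → ∀ β : X → ℝ≥0∞, BddVarExponent μ β →
      p ≤ᵐ[μ] β → StrictlyBelow μ β (sobolevExponent Q s p) →
      CompactEmbedding (hajlaszBesov μ s p q) (hajlaszBesovNorm μ s p q)
        (varLebesgue μ β) (varLebesgueNorm μ β)) ∧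
    (∀ β t : X → ℝ≥0∞, BddVarExponent μ β → BddLogExponent μ t → StrictlyBelow μ t s →
      p ≤ᵐ[μ] β → StrictlyBelow μ β (sobolevExponent Q t p) →
      CompactEmbedding (hajlaszBesov μ s p q) (hajlaszBesovNorm μ s p q)
        (varLebesgue μ β) (varLebesgueNorm μ β)) := by
  have : μ.IsOpenPosMeasure := isOpenPosMeasure_of_ball_pos fun x r hr => (hball x r hr).1
  have : IsFiniteMeasure μ :=
    isFiniteMeasure_of_totallyBounded htb fun x r hr => (hball x r hr).2
  obtain ⟨a, b, ha, hpb, -⟩ := hp.exists_bounds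
  obtain ⟨_, _, _, hsb, -⟩ := hs.exists_bounds
  have hpt : ∀ x, p x ≠ ∞ := fun x => (hpb x).1
  have hLp : ∀ u ∈ varLebesgue μ p, varLebesgueNorm μ p u < ∞ := fun u hu =>
    luxNorm_lt_top_of_mem_varLebesgue hp.toVarExponent (Eventually.of_forall hpt) hu
  have hTL : ∀ u ∈ hajlaszTL μ s p q, hajlaszTLNorm μ s p q u < ∞ := fun u hu =>
    ENNReal.add_lt_top.mpr ⟨hLp u hu.2, hu.1⟩
  have hB : ∀ u ∈ hajlaszBesov μ s p q, hajlaszBesovNorm μ s p q u < ∞ := fun u hu =>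
    ENNReal.add_lt_top.mpr ⟨hLp u hu.2, hu.1⟩
  have hμ : ∀ {K : ℝ≥0∞}, K ≠ ∞ → μ Set.univ + (1 + K) ≠ ∞ := fun hK =>
    ENNReal.add_ne_top.mpr ⟨measure_ne_top μ _, ENNReal.add_ne_top.mpr ⟨ENNReal.one_ne_top, hK⟩⟩
  refine ⟨fun β hβ _ hβγ => ?_, fun hqp β hβ _ hβγ => ?_, fun β t hβ ht hts _ hβσ => ?_⟩
  · exact compactEmbedding_of_hajlaszPair hball htb hQ hreg hp hs hsp hβ hβγ
      (hμ ENNReal.one_ne_top) hTL fun u _ l hl =>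
        exists_hajlaszPair_of_hajlaszTLNorm_lt hp.measurable hp.ne_zero hpt hq.ne_zero hl
  · obtain ⟨K, hK, h⟩ := exists_hajlaszPair_of_hajlaszBesovNorm_lt_of_le (s := s) hp.measurable
      hp.ne_zero hpt (fun x => (hpb x).2.2) hq hqp
    exact compactEmbedding_of_hajlaszPair hball htb hQ hreg hp hs hsp hβ hβγ (hμ hK) hB
      fun u _ l hl => h u l hl
  · obtain ⟨_, _, _, htfin, -⟩ := ht.exists_bounds
    obtain ⟨K, hK, h⟩ := exists_hajlaszPair_of_hajlaszBesovNorm_lt_of_lt hp.measurable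
      hp.ne_zero hpt ha (fun x => (hpb x).2.1) (fun x => (hpb x).2.2) hq
      (fun x => (hsb x).1) (fun x => (htfin x).1) hts
    -- The criterion is applied with smoothness `t`; the condition `t p ≪ Q` follows from `t ≤ s`
    -- a.e.
    exact compactEmbedding_of_hajlaszPair hball htb hQ hreg hp ht
      (hts.mul_right_of_strictlyBelow hsp) hβ hβσ (hμ hK) hB fun u _ l hl => h u l hl
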